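/- **Setting.** Let $(R_i,Z_{1i},Z_{2i})$, $i=1,2,\dots$, be i.i.d., with $R_i\in\{0,1\}$, $Z_{2i}\in\mathbb R$ (used only when $R_i=1$) and $Z_{1i}$ in a measurable space; write $(R,Z_1,Z_2)$ for a generic observation. Data are missing at random, $\Pr(R=1\mid Z_1,Z_2)=\Pr(R=1\mid Z_1)$, and the parametric model $\pi(z_1;\gamma)$, $\gamma\in\Gamma\subseteq\mathbb R^p$, is correctly specified: $\Pr(R=1\mid Z_1)=\pi(Z_1;\gamma_0)>0$ a.s. Let $\psi_\mu,\psi_\sigma:\mathbb R\to\mathbb R$ be Borel functions, $\mathcal B\subset\mathbb R\times(0,\infty)$ the parameter space of $\beta=(\mu,\sigma)'$, $\beta_0=(\mu_0,\sigma_0)'\in\mathcal B$, $A=E\{\psi_\mu(\sigma_0^{-1}(Z_2-\mu_0))\}$, $B=E\{\psi_\sigma^2(\sigma_0^{-1}(Z_2-\mu_0))\}$, and $$m_\psi(Z_2;\beta)=\begin{pmatrix}\psi_\mu(\sigma^{-1}(Z_2-\mu))-A\\ \psi_\sigma^2(\sigma^{-1}(Z_2-\mu))-B\end{pmatrix},\qquad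 \varphi(Z,R;\beta,\gamma)=\frac{R}{\pi(Z_1;\gamma)}\,m_\psi(Z_2;\beta).$$ Let $m_\gamma(R,Z_1;\gamma)\in\mathbb R^p$ be an estimating function. With probability tending to one, let $\hat\gamma\in\Gamma$ solve $\sum_{i=1}^n m_\gamma(R_i,Z_{1i};\gamma)=0$ and let $\hat\beta=(\hat\mu,\hat\sigma)'\in\mathcal B$ (the robust IPW estimator) solve $\sum_{i=1}^n\varphi(Z_i,R_i;\beta,\hat\gamma)=0$. Assume $\hat\gamma\to\gamma_0$ in probability. **(a) Consistency.** $\hat\beta\to\beta_0$ in probability if: there is an open neighborhood $G$ of $\gamma_0$ on which a.s. $\gamma\mapsto\pi(Z_1;\gamma)$ is continuously differentiable, and $E\{\sup_{\beta\in\mathcal B,\gamma\in G}\|\varphi(Z,R;\beta,\gamma)\|\}<\infty$; $\mathcal B$ is compact and $E\{m_\psi(Z_2;\beta)\}=0$ with $\beta\in\mathcal B$ only for $\beta=\beta_0$; for some $\varepsilon>0$, $1\ge\pi(Z_1;\gamma_0)>\varepsilon$ a.s.; for each $(\mu,\sigma)'\in\mathcal B$, a.s. $\psi_\mu(\sigma^{-1}(Z_2-\mu))$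 and $\psi_\sigma(\sigma^{-1}(Z_2-\mu))$ are continuous in the parameter at $(\mu,\sigma)'$; and $E\{\sup_{\mathcal B}|\psi_\mu(\sigma^{-1}(Z_2-\mu))|^2\}+E\{\sup_{\mathcal B}|\psi_\sigma^2(\sigma^{-1}(Z_2-\mu))|^2\}<\infty$. **(b) Asymptotic normality.** Let $\theta=(\mu,\sigma,\gamma')'$, $\theta_0=(\mu_0,\sigma_0,\gamma_0')'$, and let $\tilde\varphi(\theta)$ stack $\varphi(Z,R;\beta,\gamma)$ and $m_\gamma(R,Z_1;\gamma)$. If $\hat\beta\to\beta_0$ in probability (for instance by (a)) and: $\theta_0$ is interior to $\mathcal B\times\Gamma$; $E\{\tilde\varphi(\theta_0)\}=0$ and $E\|\tilde\varphi(\theta_0)\|^2<\infty$; on a neighborhood $\mathcal N$ of $\theta_0$, $\tilde\varphi$ is a.s. continuously differentiable and $E\{\sup_{\theta\in\mathcal N}\|\nabla_\theta\tilde\varphi(\theta)\|\}<\infty$; and $E\{\nabla_\theta\tilde\varphi(\theta_0)\}'E\{\nabla_\theta\tilde\varphi(\theta_0)\}$ is nonsingular; then $IF(Z,R;\beta_0)$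 is square integrable and $$\sqrt n\,(\hat\beta-\beta_0)\overset{d}{\to}N\big(0,\,E\{IF(Z,R;\beta_0)\,IF(Z,R;\beta_0)'\}\big),$$ where $$IF(Z,R;\beta)=-\Big\{E\Big[\tfrac{\partial m_\psi(Z_2;\beta)}{\partial\beta'}\Big]\Big\}^{-1}\Big\{\varphi(Z,R;\beta,\gamma_0)-E\Big[\tfrac{\partial\varphi(Z,R;\beta,\gamma_0)}{\partial\gamma'}\Big]\Big\{E\Big[\tfrac{\partial m_\gamma(R,Z_1;\gamma_0)}{\partial\gamma'}\Big]\Big\}^{-1}m_\gamma(R,Z_1;\gamma_0)\Big\}.$$ **(c)** If $\psi_\mu$ and $\psi_\sigma$ are bounded, then $IF$ is bounded in $Z_2$: for fixed $\beta$ and fixed values of $R$ and $Z_1$ it is a bounded function of $Z_2$. -/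

import Mathlib

open MeasureTheory ProbabilityTheory Filter Topology Matrix

noncomputable section

namespace RIPW

/-- `ℝᵏ` with its Euclidean norm, coordinates indexed by `ι`. -/
abbrev Euc (ι : Type) [Fintype ι] : Type := EuclideanSpace ℝ ι

/-- One observation `(R, Z₁, Z₂)`: observation status, covariate, outcome. -/
abbrev Obs (𝒵 : Type*) : Type _ := ℝ × 𝒵 × ℝ

/-- The events `E n` have probability tending to one. -/
def WithProbToOne {Ω : Type*} [MeasurableSpace Ω] (P : Measure Ω) (E : ℕ → Set Ω) : Prop :=
  Tendsto (fun n => P (E n)ᶜ) atTop (𝓝 0)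

/-- `E {sup_{a ∈ S} F a} < ∞` for a nonnegative random function `F`, stated through an integrable
majorant of the supremum, so that no measurability of the supremum is presupposed. -/
def ExpSupFinite {Ω α : Type*} [MeasurableSpace Ω] (P : Measure Ω) (S : Set α)
    (F : Ω → α → ℝ) : Prop :=
  ∃ g : Ω → ℝ, Integrable g P ∧ ∀ᵐ ω ∂P, ∀ a ∈ S, F ω a ≤ g ω

/-- The matrix `E [∂ f / ∂ x']` at `x`, where `f` is a random vector-valued function of `x`. -/
def expJacobian {Ω : Type*} [MeasurableSpace Ω] (P : Measure Ω) {ι κ : Type}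
    [Fintype ι] [Fintype κ] [DecidableEq κ] (f : Ω → Euc κ → Euc ι) (x : Euc κ) :
    Matrix ι κ ℝ :=
  Matrix.of fun i j => ∫ ω, (fderiv ℝ (f ω) x (EuclideanSpace.single j 1)) i ∂P

/-- `(ψ_μ((z₂ - μ)/σ) - A, ψ_σ²((z₂ - μ)/σ) - B)'`, where `β = (μ, σ)'`. -/
def mPsi (ψμ ψσ : ℝ → ℝ) (A B : ℝ) (z₂ : ℝ) (β : Euc (Fin 2)) : Euc (Fin 2) :=
  !₂[ψμ ((z₂ - β 0) / β 1) - A, ψσ ((z₂ - β 0) / β 1) ^ 2 - B]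

/-- The inverse probability weighted estimating function: `(r / π(z₁; γ)) m_ψ(z₂; β)`. -/
def phi {𝒵 : Type*} {p : ℕ} (ψμ ψσ : ℝ → ℝ) (A B : ℝ) (π : 𝒵 → Euc (Fin p) → ℝ)
    (w : Obs 𝒵) (β : Euc (Fin 2)) (γ : Euc (Fin p)) : Euc (Fin 2) :=
  (w.1 / π w.2.1 γ) • mPsi ψμ ψσ A B w.2.2 β

/-- The parameter `θ = (μ, σ, γ')'`. -/
def joinParam {p : ℕ} (β : Euc (Fin 2)) (γ : Euc (Fin p)) : Euc (Fin 2 ⊕ Fin p) :=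
  WithLp.toLp 2 (Sum.elim β γ)

/-- The component `(μ, σ)'` of `θ`. -/
def betaPart {p : ℕ} (θ : Euc (Fin 2 ⊕ Fin p)) : Euc (Fin 2) :=
  WithLp.toLp 2 fun i => θ (Sum.inl i)

/-- The component `γ` of `θ`. -/
def gammaPart {p : ℕ} (θ : Euc (Fin 2 ⊕ Fin p)) : Euc (Fin p) :=
  WithLp.toLp 2 fun i => θ (Sum.inr i)

/-- The estimating functions for `(μ, σ)` and for `γ`, stacked, as a function of `θ`. -/
def phiStacked {𝒵 : Type*} {p : ℕ} (ψμ ψσ : ℝ → ℝ) (A B : ℝ) (π : 𝒵 → Euc (Fin p) → ℝ)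
    (mγ : ℝ → 𝒵 → Euc (Fin p) → Euc (Fin p)) (w : Obs 𝒵) (θ : Euc (Fin 2 ⊕ Fin p)) :
    Euc (Fin 2 ⊕ Fin p) :=
  joinParam (phi ψμ ψσ A B π w (betaPart θ) (gammaPart θ)) (mγ w.1 w.2.1 (gammaPart θ))

/-- The influence function at `β`, evaluated at the observation `w`; `Q` is the law of an observation
`W = (R, Z₁, Z₂)`, under which the expectations are taken:
`-{E[∂m_ψ/∂β']}⁻¹ {φ(w; β, γ₀) - E[∂φ(W; β, γ₀)/∂γ'] {E[∂m_γ(W; γ₀)/∂γ']}⁻¹ m_γ(w; γ₀)}`. -/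
def influence {𝒵 : Type*} [MeasurableSpace 𝒵] (Q : Measure (Obs 𝒵)) {p : ℕ}
    (ψμ ψσ : ℝ → ℝ) (A B : ℝ) (π : 𝒵 → Euc (Fin p) → ℝ)
    (mγ : ℝ → 𝒵 → Euc (Fin p) → Euc (Fin p)) (γ₀ : Euc (Fin p)) (β : Euc (Fin 2))
    (w : Obs 𝒵) : Euc (Fin 2) :=
  WithLp.toLp 2 (-((expJacobian Q (fun v => mPsi ψμ ψσ A B v.2.2) β)⁻¹ *ᵥ
    ((phi ψμ ψσ A B π w β γ₀).ofLp -
      expJacobian Q (fun v γ => phi ψμ ψσ A B π v β γ) γ₀ *ᵥ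
        ((expJacobian Q (fun v => mγ v.1 v.2.1) γ₀)⁻¹ *ᵥ (mγ w.1 w.2.1 γ₀).ofLp))))

/-- The matrix `E {X X'}` of a random vector `X`. -/
def secondMoment {Ω : Type*} [MeasurableSpace Ω] (P : Measure Ω) {ι : Type} [Fintype ι]
    (X : Ω → Euc ι) : Matrix ι ι ℝ :=
  Matrix.of fun i j => ∫ ω, X ω i * X ω j ∂P

/-- The law of the observation `(R, Z₁, Z₂)` with index `0`, the common law of all observations. -/
def obsLaw {Ω 𝒵 : Type*} [MeasurableSpace Ω] [MeasurableSpace 𝒵] (P : Measure Ω)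
    (R : ℕ → Ω → ℝ) (Z₁ : ℕ → Ω → 𝒵) (Z₂ : ℕ → Ω → ℝ) : Measure (Obs 𝒵) :=
  P.map fun ω => (R 0 ω, Z₁ 0 ω, Z₂ 0 ω)

/-- The data generating mechanism, with the model `π(·; γ)` for the missingness probability
correctly specified at `γ₀`. -/
structure DataModel {Ω 𝒵 : Type*} [MeasurableSpace Ω] [MeasurableSpace 𝒵] (P : Measure Ω)
    {p : ℕ} (R : ℕ → Ω → ℝ) (Z₁ : ℕ → Ω → 𝒵) (Z₂ : ℕ → Ω → ℝ)
    (π : 𝒵 → Euc (Fin p) → ℝ) (γ₀ : Euc (Fin p)) : Prop where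
  measurable_R : ∀ i, Measurable (R i)
  measurable_Z₁ : ∀ i, Measurable (Z₁ i)
  measurable_Z₂ : ∀ i, Measurable (Z₂ i)
  binary : ∀ i ω, R i ω = 0 ∨ R i ω = 1
  indep : iIndepFun (fun i ω => (R i ω, Z₁ i ω, Z₂ i ω)) P
  identDistrib : ∀ i, IdentDistrib (fun ω => (R i ω, Z₁ i ω, Z₂ i ω))
    (fun ω => (R 0 ω, Z₁ 0 ω, Z₂ 0 ω)) P P
  /-- Missing at random: `Pr(R = 1 | Z₂, Z₁)` is a function of `Z₁` alone. -/
  missingAtRandom :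
    P[R 0 | MeasurableSpace.comap (fun ω => (Z₁ 0 ω, Z₂ 0 ω)) inferInstance] =ᵐ[P]
      P[R 0 | MeasurableSpace.comap (Z₁ 0) inferInstance]
  /-- Correct specification: `Pr(R = 1 | Z₁) = π(Z₁; γ₀)`. -/
  correctlySpecified :
    P[R 0 | MeasurableSpace.comap (Z₁ 0) inferInstance] =ᵐ[P] fun ω => π (Z₁ 0 ω) γ₀
  positivity : ∀ᵐ ω ∂P, 0 < π (Z₁ 0 ω) γ₀
  measurable_π : ∀ γ, Measurable fun z => π z γ

/-- Regularity conditions for consistency; `ℬ` is the parameter space of `β = (μ, σ)'` and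
`Q` the law of an observation `w = (R, Z₁, Z₂)`. -/
structure ConsistencyConditions {𝒵 : Type*} [MeasurableSpace 𝒵] (Q : Measure (Obs 𝒵))
    {p : ℕ} (ψμ ψσ : ℝ → ℝ) (A B : ℝ) (π : 𝒵 → Euc (Fin p) → ℝ)
    (ℬ : Set (Euc (Fin 2))) (β₀ : Euc (Fin 2)) (γ₀ : Euc (Fin p)) : Prop where
  /-- Near `γ₀`, `π(Z₁; γ)` is continuously differentiable in `γ`, and the weighted estimating
  function is dominated, uniformly over `ℬ`. -/
  smooth_π : ∃ G : Set (Euc (Fin p)), IsOpen G ∧ γ₀ ∈ G ∧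
    (∀ᵐ w ∂Q, ContDiffOn ℝ 1 (π w.2.1) G) ∧
    ExpSupFinite Q (ℬ ×ˢ G) fun w x => ‖phi ψμ ψσ A B π w x.1 x.2‖
  compact : IsCompact ℬ
  /-- Identification: the moment equation holds at no other point of `ℬ`. -/
  identification : ∀ β ∈ ℬ, ∫ w, mPsi ψμ ψσ A B w.2.2 β ∂Q = 0 → β = β₀
  overlap : ∃ ε > 0, ∀ᵐ w ∂Q, ε < π w.2.1 γ₀ ∧ π w.2.1 γ₀ ≤ 1
  continuous_ψ : ∀ β ∈ ℬ, ∀ᵐ w ∂Q,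
    ContinuousAt (fun b : Euc (Fin 2) => ψμ ((w.2.2 - b 0) / b 1)) β ∧
    ContinuousAt (fun b : Euc (Fin 2) => ψσ ((w.2.2 - b 0) / b 1)) β
  moment_μ : ExpSupFinite Q ℬ fun w b => |ψμ ((w.2.2 - b 0) / b 1)| ^ 2
  moment_σ : ExpSupFinite Q ℬ fun w b => |ψσ ((w.2.2 - b 0) / b 1) ^ 2| ^ 2

/-- Regularity conditions for asymptotic normality; `ℬ` and `Γ` are the parameter spaces of
`β = (μ, σ)'` and `γ`, and `Q` is the law of an observation `w = (R, Z₁, Z₂)`. -/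
structure NormalityConditions {𝒵 : Type*} [MeasurableSpace 𝒵] (Q : Measure (Obs 𝒵))
    {p : ℕ} (ψμ ψσ : ℝ → ℝ) (A B : ℝ) (π : 𝒵 → Euc (Fin p) → ℝ)
    (mγ : ℝ → 𝒵 → Euc (Fin p) → Euc (Fin p)) (ℬ : Set (Euc (Fin 2))) (Γ : Set (Euc (Fin p)))
    (β₀ : Euc (Fin 2)) (γ₀ : Euc (Fin p)) : Prop where
  interior : joinParam β₀ γ₀ ∈ interior {θ | betaPart θ ∈ ℬ ∧ gammaPart θ ∈ Γ}
  mean_zero : ∫ w, phiStacked ψμ ψσ A B π mγ w (joinParam β₀ γ₀) ∂Q = 0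
  square_integrable : MemLp (fun w => phiStacked ψμ ψσ A B π mγ w (joinParam β₀ γ₀)) 2 Q
  /-- Continuous differentiability, with dominated derivative, in a neighborhood of `θ₀`. -/
  smooth : ∃ N : Set (Euc (Fin 2 ⊕ Fin p)), IsOpen N ∧ joinParam β₀ γ₀ ∈ N ∧
    (∀ᵐ w ∂Q, ContDiffOn ℝ 1 (phiStacked ψμ ψσ A B π mγ w) N) ∧
    ExpSupFinite Q N fun w θ => ‖fderiv ℝ (phiStacked ψμ ψσ A B π mγ w) θ‖
  nonsingular :
    IsUnit ((expJacobian Q (fun w => phiStacked ψμ ψσ A B π mγ w) (joinParam β₀ γ₀))ᵀ *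
      expJacobian Q (fun w => phiStacked ψμ ψσ A B π mγ w) (joinParam β₀ γ₀))

end RIPW

end

/-!
Since the data are missing at random, weighting the observations by `R / π(Z₁; γ₀)` does not change
the law of `(Z₁, Z₂)`, so `E φ(β, γ₀) = E m_ψ(β)` for every `β`.

Consistency: for `β ≠ β₀` in `ℬ` this mean is nonzero. The oscillation of `φ` over a small
neighborhood of `(β, γ₀)` has a majorant whose mean is smaller than `‖E φ(β, γ₀)‖`, so by the law of
large numbers the estimating equation has no solution there, with probability tending to one.
Compactness leaves only the neighborhoods of `β₀`.

Normality: expanding the stacked estimating equation `∑ Φᵢ(θ) = 0` around `θ₀` gives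
`√n (θhat - θ₀) = -{E ∇Φ(θ₀)}⁻¹ n^{-1/2} ∑ Φᵢ(θ₀) + o_P(1)`. The expected Jacobian is block upper
triangular, since `m_γ` does not involve `β`, and its inverse maps `Φ(θ₀)` to a vector with `β` part
`-IF`. The central limit theorem and Slutsky's lemma conclude.

Boundedness: `z₂` enters the influence function only through `m_ψ`, on which it depends affinely.
-/

noncomputable section

namespace RIPW

section WithProbToOne

variable {Ω : Type*} [MeasurableSpace Ω] {P : Measure Ω}

lemma WithProbToOne.mono {E F : ℕ → Set Ω} (hE : WithProbToOne P E)
    (h : ∀ᶠ n in atTop, E n ⊆ F n) : WithProbToOne P F := by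
  refine tendsto_of_tendsto_of_tendsto_of_le_of_le' tendsto_const_nhds hE
    (.of_forall fun _ => zero_le) ?_
  filter_upwards [h] with n hn
  exact measure_mono (Set.compl_subset_compl.2 hn)

lemma WithProbToOne.of_ae {p : Ω → Prop} (h : ∀ᵐ ω ∂P, p ω) :
    WithProbToOne P fun _ => {ω | p ω} :=
  tendsto_const_nhds.congr fun _ => (mem_ae_iff.1 h).symm

lemma WithProbToOne.inter {E F : ℕ → Set Ω} (hE : WithProbToOne P E) (hF : WithProbToOne P F) :
    WithProbToOne P fun n => E n ∩ F n := by
  refine tendsto_of_tendsto_of_tendsto_of_le_of_le tendsto_const_nhds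
    (by simpa only [add_zero] using Tendsto.add hE hF) (fun _ => zero_le) fun n => ?_
  simp only [Set.compl_inter]
  exact measure_union_le _ _

lemma WithProbToOne.biInter {ι : Type*} (s : Finset ι) {E : ι → ℕ → Set Ω}
    (hE : ∀ i ∈ s, WithProbToOne P (E i)) : WithProbToOne P fun n => ⋂ i ∈ s, E i n := by
  classical
  induction s using Finset.induction_on with
  | empty => simp [WithProbToOne]
  | insert i s _ ih =>
    simp only [Finset.mem_insert, forall_eq_or_imp] at hE
    simpa only [Finset.set_biInter_insert] using hE.1.inter (ih hE.2)

lemma tendstoInMeasure_iff_withProbToOne {E : Type*} [SeminormedAddCommGroup E]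
    {f : ℕ → Ω → E} {g : Ω → E} :
    TendstoInMeasure P f atTop g ↔
      ∀ ε, 0 < ε → WithProbToOne P fun n => {ω | ‖f n ω - g ω‖ < ε} := by
  rw [tendstoInMeasure_iff_norm]
  simp [WithProbToOne, Set.compl_def]

lemma withProbToOne_mem_of_tendstoInMeasure {E : Type*} [SeminormedAddCommGroup E]
    {f : ℕ → Ω → E} {x : E} (hf : TendstoInMeasure P f atTop fun _ => x) {U : Set E}
    (hU : U ∈ 𝓝 x) : WithProbToOne P fun n => {ω | f n ω ∈ U} := by
  obtain ⟨ε, hε, hεU⟩ := Metric.mem_nhds_iff.1 hU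
  refine (tendstoInMeasure_iff_withProbToOne.1 hf ε hε).mono (.of_forall fun n ω hω => hεU ?_)
  rwa [Metric.mem_ball, dist_eq_norm]

lemma tendstoInMeasure_const_of_withProbToOne_mem {E : Type*} [SeminormedAddCommGroup E]
    {f : ℕ → Ω → E} {x : E} (h : ∀ U ∈ 𝓝 x, WithProbToOne P fun n => {ω | f n ω ∈ U}) :
    TendstoInMeasure P f atTop fun _ => x := by
  refine tendstoInMeasure_iff_withProbToOne.2 fun ε hε => ?_
  simpa only [Metric.mem_ball, dist_eq_norm] using h _ (Metric.ball_mem_nhds x hε)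

lemma tendstoInMeasure_comp₂_of_continuousAt {E F G : Type*} [SeminormedAddCommGroup E]
    [SeminormedAddCommGroup F] [SeminormedAddCommGroup G] {f : ℕ → Ω → E} {g : ℕ → Ω → F}
    {x : E} {y : F} (hf : TendstoInMeasure P f atTop fun _ => x)
    (hg : TendstoInMeasure P g atTop fun _ => y) {φ : E → F → G}
    (hφ : ContinuousAt (Function.uncurry φ) (x, y)) :
    TendstoInMeasure P (fun n ω => φ (f n ω) (g n ω)) atTop fun _ => φ x y := by
  refine tendstoInMeasure_const_of_withProbToOne_mem fun U hU => ?_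
  obtain ⟨s, hs, t, ht, hst⟩ := mem_nhds_prod_iff.1 (hφ hU)
  refine ((withProbToOne_mem_of_tendstoInMeasure hf hs).inter
    (withProbToOne_mem_of_tendstoInMeasure hg ht)).mono (.of_forall ?_)
  rintro n ω ⟨hω, hω'⟩
  exact hst (Set.mk_mem_prod hω hω')

lemma tendstoInMeasure_clm_comp {E F : Type*} [SeminormedAddCommGroup E] [NormedSpace ℝ E]
    [SeminormedAddCommGroup F] [NormedSpace ℝ F] (L : E →L[ℝ] F) {f : ℕ → Ω → E} {x : E}
    (hf : TendstoInMeasure P f atTop fun _ => x) :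
    TendstoInMeasure P (fun n ω => L (f n ω)) atTop fun _ => L x :=
  tendstoInMeasure_const_of_withProbToOne_mem fun _ hU =>
    withProbToOne_mem_of_tendstoInMeasure hf (L.continuous.continuousAt hU)

lemma tendstoInMeasure_of_isCompact {E : Type*} [SeminormedAddCommGroup E] {K : Set E}
    (hK : IsCompact K) {f : ℕ → Ω → E} {x : E} (hf : WithProbToOne P fun n => {ω | f n ω ∈ K})
    (h : ∀ y ∈ K, y ≠ x → ∃ U ∈ 𝓝 y, WithProbToOne P fun n => {ω | f n ω ∉ U}) :
    TendstoInMeasure P f atTop fun _ => x := by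
  refine tendstoInMeasure_const_of_withProbToOne_mem fun V hV => ?_
  obtain ⟨V', hV'V, hV'o, hxV'⟩ := mem_nhds_iff.1 hV
  have hne : ∀ y ∈ K \ V', ∃ U ∈ 𝓝 y, WithProbToOne P fun n => {ω | f n ω ∉ U} :=
    fun y hy => h y hy.1 fun hyx => hy.2 (hyx ▸ hxV')
  choose! U hU hUf using hne
  obtain ⟨t, htK, hcover⟩ := (hK.diff hV'o).elim_nhds_subcover U hU
  refine (hf.inter (WithProbToOne.biInter t fun y hy => hUf y (htK y hy))).mono
    (.of_forall ?_)
  rintro n ω ⟨hωK, hωU⟩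
  refine hV'V (by_contra fun hωV => ?_)
  obtain ⟨y, hy, hyU⟩ := Set.mem_iUnion₂.1 (hcover ⟨hωK, hωV⟩)
  exact Set.mem_iInter₂.1 hωU y hy hyU

lemma tendstoInMeasure_zero_of_norm_le_mul {E F : Type*} [NormedAddCommGroup E]
    [MeasurableSpace E] [BorelSpace E] [SeminormedAddCommGroup F] {X : ℕ → Ω → E}
    {Y : ℕ → Ω → F} (hX : ∀ n, AEMeasurable (X n) P)
    (htight : IsTightMeasureSet (Set.range fun n => P.map (X n)))
    (hYX : ∀ c > 0, WithProbToOne P fun n => {ω | ‖Y n ω‖ ≤ c * ‖X n ω‖}) :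
    TendstoInMeasure P Y atTop fun _ => 0 := by
  refine tendstoInMeasure_iff_withProbToOne.2 fun ε hε => ENNReal.tendsto_nhds_zero.2 fun e he => ?_
  obtain ⟨r, hr, hr0⟩ := ((ENNReal.tendsto_nhds_zero.1
    (tendsto_measure_norm_gt_of_isTightMeasureSet htight) (e / 2) (ENNReal.half_pos he.ne')).and
      (eventually_gt_atTop 0)).exists
  have hXr : ∀ n, P {ω | r < ‖X n ω‖} ≤ e / 2 := fun n => by
    refine le_trans ?_ ((le_iSup₂_of_le (P.map (X n)) (Set.mem_range_self n) le_rfl).trans hr)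
    rw [Measure.map_apply_of_aemeasurable (hX n)
      (measurableSet_lt measurable_const measurable_norm)]
    exact le_rfl
  filter_upwards [ENNReal.tendsto_nhds_zero.1 (hYX (ε / (2 * r)) (by positivity)) (e / 2)
    (ENNReal.half_pos he.ne')] with n hn
  refine (measure_mono fun ω hω => ?_).trans
    ((measure_union_le _ {ω | r < ‖X n ω‖}).trans ((add_le_add hn (hXr n)).trans_eq
      (ENNReal.add_halves e)))
  by_contra! hω'
  simp only [Set.mem_union, Set.mem_compl_iff, Set.mem_ofPred_eq, not_or, not_not, not_lt]
    at hω'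
  refine hω ?_
  rw [Set.mem_ofPred_eq, sub_zero]
  calc ‖Y n ω‖ ≤ ε / (2 * r) * r := hω'.1.trans (by gcongr; exact hω'.2)
    _ < ε := by field_simp; linarith

end WithProbToOne

section CentralLimit

lemma charFun_map_eq_charFun_map_inner {Ω E : Type*} [MeasurableSpace Ω] {P : Measure Ω}
    [NormedAddCommGroup E] [InnerProductSpace ℝ E] [CompleteSpace E] [MeasurableSpace E]
    [BorelSpace E] {Z : Ω → E} (hZ : AEMeasurable Z P) (t : E) :
    charFun (P.map Z) t = charFun (P.map fun ω => inner ℝ t (Z ω)) 1 := by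
  rw [charFun_eq_charFunDual_toDualMap, charFunDual_eq_charFun_map_one,
    AEMeasurable.map_map_of_aemeasurable (by fun_prop) hZ]
  rfl

variable {Ω Ω' E : Type*} [MeasurableSpace Ω] [MeasurableSpace Ω'] {P : Measure Ω}
  [IsProbabilityMeasure P] {P' : Measure Ω'} [IsProbabilityMeasure P'] [NormedAddCommGroup E]
  [InnerProductSpace ℝ E] [FiniteDimensional ℝ E] [MeasurableSpace E] [BorelSpace E]
  {X : ℕ → Ω → E} {Z : Ω' → E}

lemma isTightMeasureSet_range_map (h : TendstoInDistribution X atTop Z (fun _ => P) P') :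
    IsTightMeasureSet (Set.range fun n => P.map (X n)) := by
  have (n : ℕ) := Measure.isProbabilityMeasure_map (h.forall_aemeasurable n)
  have := Measure.isProbabilityMeasure_map h.aemeasurable_limit
  exact isTightMeasureSet_of_tendsto_charFun (f := charFun (P'.map Z))
    (by fun_prop) (ProbabilityMeasure.tendsto_iff_tendsto_charFun.1 h.tendsto)

lemma tendstoInDistribution_of_forall_inner (hX : ∀ n, AEMeasurable (X n) P)
    (hZ : AEMeasurable Z P')
    (h : ∀ t : E, TendstoInDistribution (fun n ω => inner ℝ t (X n ω)) atTop
      (fun ω => inner ℝ t (Z ω)) (fun _ => P) P') :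
    TendstoInDistribution X atTop Z (fun _ => P) P' where
  forall_aemeasurable := hX
  aemeasurable_limit := hZ
  tendsto := ProbabilityMeasure.tendsto_iff_tendsto_charFun.2 fun t => by
    simpa only [ProbabilityMeasure.coe_mk, ← charFun_map_eq_charFun_map_inner (hX _),
      ← charFun_map_eq_charFun_map_inner hZ]
      using ProbabilityMeasure.tendsto_iff_tendsto_charFun.1 (h t).tendsto 1

end CentralLimit

section SecondMoment

variable {Ω : Type*} [MeasurableSpace Ω] {P : Measure Ω} {ι : Type} [Fintype ι] {X : Ω → Euc ι}

lemma integrable_mul_coord (hX : MemLp X 2 P) (i j : ι) :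
    Integrable (fun ω => X ω i * X ω j) P := by
  have hcoord : ∀ i, MemLp (fun ω => X ω i) 2 P := fun i =>
    (EuclideanSpace.proj i : Euc ι →L[ℝ] ℝ).comp_memLp' hX
  exact (hcoord i).integrable_mul (hcoord j)

lemma dotProduct_secondMoment (hX : MemLp X 2 P) (t : Euc ι) :
    t.ofLp ⬝ᵥ secondMoment P X *ᵥ t.ofLp = ∫ ω, inner ℝ t (X ω) ^ 2 ∂P := by
  have hint (i j : ι) : Integrable (fun ω => t i * (X ω i * X ω j * t j)) P :=
    ((integrable_mul_coord hX i j).mul_const _).const_mul _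
  have hsq (ω : Ω) : inner ℝ t (X ω) ^ 2 = ∑ i, ∑ j, t i * (X ω i * X ω j * t j) := by
    simp only [PiLp.inner_apply, sq, Finset.sum_mul_sum, Real.inner_apply]
    exact Finset.sum_congr rfl fun i _ => Finset.sum_congr rfl fun j _ => by ring
  simp_rw [hsq]
  rw [integral_finsetSum _ fun i _ => integrable_finsetSum _ fun j _ => hint i j]
  refine Finset.sum_congr rfl fun i _ => ?_
  rw [integral_finsetSum _ fun j _ => hint i j]
  simp [mulVec, dotProduct, secondMoment, Finset.mul_sum, integral_const_mul, integral_mul_const]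

lemma posSemidef_secondMoment (hX : MemLp X 2 P) : (secondMoment P X).PosSemidef := by
  refine Matrix.PosSemidef.of_dotProduct_mulVec_nonneg ?_ fun t => ?_
  · ext i j
    simp [secondMoment, mul_comm]
  · rw [star_trivial, dotProduct_secondMoment hX (WithLp.toLp 2 t)]
    exact integral_nonneg fun _ => sq_nonneg _

lemma hasLaw_inner_multivariateGaussian [DecidableEq ι] {S : Matrix ι ι ℝ} (hS : S.PosSemidef)
    (t : Euc ι) :
    HasLaw (fun x : Euc ι => inner ℝ t x) (gaussianReal 0 (t.ofLp ⬝ᵥ S *ᵥ t.ofLp).toNNReal)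
      (multivariateGaussian 0 S) where
  map_eq := by
    have hnonneg : 0 ≤ t.ofLp ⬝ᵥ S *ᵥ t.ofLp := by
      simpa only [star_trivial] using hS.dotProduct_mulVec_nonneg t.ofLp
    refine Measure.ext_of_charFun (funext fun u => ?_)
    have hsmul : charFun ((multivariateGaussian 0 S).map (innerSL ℝ t)) u =
        charFun (multivariateGaussian 0 S) (u • t) := by
      rw [charFun_map_eq_charFunDual_smul, charFun_eq_charFunDual_toDualMap, map_smul]
      rfl
    refine hsmul.trans ?_
    rw [charFun_gaussianReal, charFun_multivariateGaussian hS]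
    congr 1
    simp only [inner_zero_right, WithLp.ofLp_smul, mulVec_smul, dotProduct_smul, smul_dotProduct,
      smul_eq_mul, Real.coe_toNNReal _ hnonneg]
    push_cast
    ring

end SecondMoment

section Sampling

variable {Ω 𝒲 : Type*} [MeasurableSpace Ω] [MeasurableSpace 𝒲] {P : Measure Ω} {Q : Measure 𝒲}
  {W : ℕ → Ω → 𝒲}

lemma ae_forall_of_hasLaw (hW : ∀ i, HasLaw (W i) Q P) {p : 𝒲 → Prop} (hp : ∀ᵐ w ∂Q, p w) :
    ∀ᵐ ω ∂P, ∀ i, p (W i ω) :=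
  ae_all_iff.2 fun i => ae_of_ae_map (hW i).aemeasurable ((hW i).map_eq.symm ▸ hp)

lemma identDistrib_comp_of_hasLaw {E : Type*} [MeasurableSpace E] (hW : ∀ i, HasLaw (W i) Q P)
    {f : 𝒲 → E} (hf : AEMeasurable f Q) (i j : ℕ) :
    IdentDistrib (fun ω => f (W i ω)) (fun ω => f (W j ω)) P P :=
  ((hW i).identDistrib (hW j)).comp_of_aemeasurable ((hW i).map_eq.symm ▸ hf)

lemma iIndepFun_comp_of_hasLaw {E : Type*} [MeasurableSpace E] (hW : ∀ i, HasLaw (W i) Q P)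
    (hindep : iIndepFun W P) {f : 𝒲 → E} (hf : AEMeasurable f Q) :
    iIndepFun (fun i ω => f (W i ω)) P :=
  hindep.comp₀ (fun _ => f) (fun i => (hW i).aemeasurable) fun i => (hW i).map_eq.symm ▸ hf

lemma memLp_comp_of_hasLaw {E : Type*} [NormedAddCommGroup E] {q : ENNReal} {X : Ω → 𝒲}
    (hX : HasLaw X Q P) {f : 𝒲 → E} (hf : MemLp f q Q) : MemLp (fun ω => f (X ω)) q P :=
  MemLp.comp_of_map (hX.map_eq.symm ▸ hf) hX.aemeasurable

lemma tendstoInMeasure_average [IsFiniteMeasure P] {E : Type*} [NormedAddCommGroup E]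
    [NormedSpace ℝ E] [CompleteSpace E] [MeasurableSpace E] [BorelSpace E]
    (hW : ∀ i, HasLaw (W i) Q P) (hindep : iIndepFun W P) {f : 𝒲 → E} (hf : Integrable f Q) :
    TendstoInMeasure P (fun (n : ℕ) ω => (n : ℝ)⁻¹ • ∑ i ∈ Finset.range n, f (W i ω)) atTop
      fun _ => ∫ w, f w ∂Q := by
  have hfW (i : ℕ) : Integrable (fun ω => f (W i ω)) P :=
    memLp_one_iff_integrable.1 (memLp_comp_of_hasLaw (hW i) (memLp_one_iff_integrable.2 hf))
  have hfm := hf.aestronglyMeasurable.aemeasurable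
  refine tendstoInMeasure_of_tendsto_ae (fun n => AEStronglyMeasurable.const_smul
    (Finset.aestronglyMeasurable_fun_sum _ fun i _ => (hfW i).aestronglyMeasurable) _) ?_
  rw [← (hW 0).integral_comp hf.aestronglyMeasurable]
  exact strong_law_ae (fun i ω => f (W i ω)) (hfW 0)
    (fun i j hij => (iIndepFun_comp_of_hasLaw hW hindep hfm).indepFun hij)
    fun i => identDistrib_comp_of_hasLaw hW hfm i 0

lemma tendstoInDistribution_inv_sqrt_mul_sum [IsProbabilityMeasure P] {Ω' : Type*}
    [MeasurableSpace Ω'] {P' : Measure Ω'} [IsProbabilityMeasure P'] {Y : Ω' → ℝ}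
    (hW : ∀ i, HasLaw (W i) Q P) (hindep : iIndepFun W P) {f : 𝒲 → ℝ} (hf : MemLp f 2 Q)
    (hmean : ∫ w, f w ∂Q = 0) (hY : HasLaw Y (gaussianReal 0 (∫ w, f w ^ 2 ∂Q).toNNReal) P') :
    TendstoInDistribution (fun (n : ℕ) ω => (√(n : ℝ))⁻¹ * ∑ k ∈ Finset.range n, f (W k ω)) atTop Y
      (fun _ => P) P' := by
  have hfm := hf.aestronglyMeasurable.aemeasurable
  have hmean' : ∫ ω, f (W 0 ω) ∂P = 0 :=
    ((hW 0).integral_comp hf.aestronglyMeasurable).trans hmean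
  have hvar : Var[fun ω => f (W 0 ω); P] = ∫ w, f w ^ 2 ∂Q := by
    rw [variance_of_integral_eq_zero
      (identDistrib_comp_of_hasLaw hW hfm 0 0).aemeasurable_fst hmean']
    exact (hW 0).integral_comp (f := fun w => f w ^ 2) (hf.aestronglyMeasurable.pow 2)
  simpa only [hmean', mul_zero, sub_zero] using tendstoInDistribution_inv_sqrt_mul_sum_sub
    (by rwa [hvar]) (memLp_comp_of_hasLaw (hW 0) hf) (iIndepFun_comp_of_hasLaw hW hindep hfm)
    fun i => identDistrib_comp_of_hasLaw hW hfm i 0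

theorem tendstoInDistribution_inv_sqrt_smul_sum [IsProbabilityMeasure P] {ι : Type} [Fintype ι]
    [DecidableEq ι] (hW : ∀ i, HasLaw (W i) Q P) (hindep : iIndepFun W P) {f : 𝒲 → Euc ι}
    (hf : MemLp f 2 Q) (hmean : ∫ w, f w ∂Q = 0) :
    TendstoInDistribution (fun (n : ℕ) ω => (√(n : ℝ))⁻¹ • ∑ k ∈ Finset.range n, f (W k ω)) atTop
      id (fun _ => P) (multivariateGaussian 0 (secondMoment Q f)) := by
  have : IsProbabilityMeasure Q := (hW 0).isProbabilityMeasure_iff.1 ‹_›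
  have hfW (i : ℕ) : AEMeasurable (fun ω => f (W i ω)) P :=
    (identDistrib_comp_of_hasLaw hW hf.aestronglyMeasurable.aemeasurable i 0).aemeasurable_fst
  refine tendstoInDistribution_of_forall_inner
    (fun n => (Finset.aemeasurable_fun_sum _ fun i _ => hfW i).const_smul (√(n : ℝ))⁻¹)
    aemeasurable_id fun t => ?_
  have hmean_t : ∫ w, inner ℝ t (f w) ∂Q = 0 := by
    rw [integral_inner (hf.integrable one_le_two), hmean, inner_zero_right]
  have hlaw := hasLaw_inner_multivariateGaussian (posSemidef_secondMoment hf) t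
  rw [dotProduct_secondMoment hf] at hlaw
  simpa only [inner_smul_right, inner_sum, id, Function.comp_apply, innerSL_apply_apply] using
    tendstoInDistribution_inv_sqrt_mul_sum hW hindep ((innerSL ℝ t).comp_memLp' hf) hmean_t hlaw

end Sampling

section Oscillation

variable {𝒲 X : Type*} [MeasurableSpace 𝒲] {Q : Measure 𝒲}

lemma aemeasurable_biSup_of_lowerSemicontinuousOn [TopologicalSpace X]
    [TopologicalSpace.SeparableSpace X] {U : Set X} (hU : IsOpen U) {u : 𝒲 → X → ENNReal}
    (hmeas : ∀ x, AEMeasurable (fun w => u w x) Q)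
    (hlsc : ∀ᵐ w ∂Q, LowerSemicontinuousOn (u w) U) :
    AEMeasurable (fun w => ⨆ x ∈ U, u w x) Q := by
  obtain ⟨s, hs, hdense⟩ := TopologicalSpace.exists_countable_dense X
  refine (AEMeasurable.biSup (U ∩ s) (hs.mono Set.inter_subset_right)
    fun x _ => hmeas x).congr ?_
  filter_upwards [hlsc] with w hw
  refine le_antisymm (biSup_mono fun x hx => hx.1) (iSup₂_le fun x hx => le_of_not_gt fun hlt => ?_)
  have hgt := hw x hx _ hlt
  rw [hU.nhdsWithin_eq hx] at hgt
  obtain ⟨y, hys, hy, hyU⟩ := ((mem_closure_iff_frequently.1 (hdense x)).and_eventually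
    (hgt.and (hU.mem_nhds hx))).exists
  exact hy.not_ge (le_iSup₂_of_le y ⟨hyU, hys⟩ le_rfl)

lemma lowerSemicontinuous_biSup_ball {Y : Type*} [TopologicalSpace Y] [PseudoMetricSpace X]
    {u : Y → X → ENNReal} (hu : ∀ c, LowerSemicontinuous fun y => u y c) (r : ℝ) :
    LowerSemicontinuous fun q : Y × X => ⨆ c ∈ Metric.ball q.2 r, u q.1 c := by
  rintro ⟨y, x⟩ a ha
  obtain ⟨c, hc, hac⟩ := lt_biSup_iff.1 ha
  have hfst : ∀ᶠ q : Y × X in 𝓝 (y, x), a < u q.1 c :=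
    (continuous_fst.tendsto (y, x)).eventually (hu c y a hac)
  have hsnd : ∀ᶠ q : Y × X in 𝓝 (y, x), q.2 ∈ Metric.ball c r :=
    (continuous_snd.tendsto (y, x)).eventually
      (Metric.isOpen_ball.mem_nhds (Metric.mem_ball_comm.1 hc))
  filter_upwards [hfst, hsnd] with q hq hqc
  exact hq.trans_le (le_iSup₂_of_le c (Metric.mem_ball_comm.1 hqc) le_rfl)

lemma tendsto_biSup_ball_zero [PseudoMetricSpace X] {u : X → ENNReal} {x₀ : X}
    (hu : Tendsto u (𝓝 x₀) (𝓝 0)) :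
    Tendsto (fun r => ⨆ x ∈ Metric.ball x₀ r, u x) (𝓝[>] 0) (𝓝 0) := by
  refine ENNReal.tendsto_nhds_zero.2 fun ε hε => ?_
  obtain ⟨δ, hδ, hball⟩ :=
    Metric.eventually_nhds_iff_ball.1 (ENNReal.tendsto_nhds_zero.1 hu ε hε)
  filter_upwards [Ioo_mem_nhdsGT hδ] with r hr
  exact iSup₂_le fun x hx => hball x (Metric.ball_subset_ball hr.2.le hx)

/-- Capping the local suprema of `‖v w ·‖` by `g` makes them integrable majorants on `V`, and
dominated convergence applies to them. -/
lemma exists_majorant_integral_lt [PseudoMetricSpace X] {F : Type*} [NormedAddCommGroup F]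
    {v : 𝒲 → X → F} {x₀ : X}
    (hmeas : ∀ᶠ r in 𝓝[>] 0, AEMeasurable (fun w => ⨆ x ∈ Metric.ball x₀ r, ‖v w x‖ₑ) Q)
    (hlim : ∀ᵐ w ∂Q, Tendsto (v w) (𝓝 x₀) (𝓝 0)) {V : Set X} {g : 𝒲 → ℝ}
    (hg : Integrable g Q) (hdom : ∀ᵐ w ∂Q, ∀ x ∈ V, ‖v w x‖ ≤ g w) {η : ℝ} (hη : 0 < η) :
    ∃ δ > 0, ∃ h : 𝒲 → ℝ, Integrable h Q ∧ ∫ w, h w ∂Q < η ∧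
      ∀ᵐ w ∂Q, ∀ x ∈ Metric.ball x₀ δ ∩ V, ‖v w x‖ ≤ h w := by
  let b (r : ℝ) (w : 𝒲) : ENNReal :=
    min (⨆ x ∈ Metric.ball x₀ r, ‖v w x‖ₑ) (ENNReal.ofReal (g w))
  have hb_top (r : ℝ) (w : 𝒲) : b r w ≠ ⊤ := ((min_le_right _ _).trans_lt ENNReal.ofReal_lt_top).ne
  have hb_le (r : ℝ) (w : 𝒲) : ‖(b r w).toReal‖ ≤ |g w| := by
    rw [Real.norm_of_nonneg ENNReal.toReal_nonneg]
    exact ENNReal.toReal_le_of_le_ofReal (abs_nonneg _)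
      ((min_le_right _ _).trans (ENNReal.ofReal_le_ofReal (le_abs_self _)))
  have hb_meas : ∀ᶠ r in 𝓝[>] 0, AEStronglyMeasurable (fun w => (b r w).toReal) Q := by
    filter_upwards [hmeas] with r hr
    exact (hr.min hg.aestronglyMeasurable.aemeasurable.ennreal_ofReal).ennreal_toReal
      |>.aestronglyMeasurable
  have hb_lim : ∀ᵐ w ∂Q, Tendsto (fun r => (b r w).toReal) (𝓝[>] 0) (𝓝 0) := by
    filter_upwards [hlim] with w hw
    have hsup := tendsto_biSup_ball_zero (by simpa only [enorm_zero] using hw.enorm)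
    exact (ENNReal.tendsto_toReal ENNReal.zero_ne_top).comp
      (tendsto_of_tendsto_of_tendsto_of_le_of_le tendsto_const_nhds hsup
        (fun _ => zero_le) fun _ => min_le_left _ _)
  have hint : Tendsto (fun r => ∫ w, (b r w).toReal ∂Q) (𝓝[>] 0) (𝓝 0) := by
    simpa only [integral_zero] using tendsto_integral_filter_of_dominated_convergence _ hb_meas
      (.of_forall fun r => .of_forall (hb_le r)) hg.abs hb_lim
  obtain ⟨r, ⟨hr, hr_meas⟩, hr0⟩ := (((hint.eventually (gt_mem_nhds hη)).and hb_meas).and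
    self_mem_nhdsWithin).exists
  refine ⟨r, hr0, fun w => (b r w).toReal, hg.abs.mono' hr_meas (.of_forall (hb_le r)), hr, ?_⟩
  filter_upwards [hdom] with w hw x hx
  rw [← toReal_enorm, ← ofReal_norm]
  refine ENNReal.toReal_mono (hb_top r w) (le_min ?_ (ENNReal.ofReal_le_ofReal (hw x hx.2)))
  exact le_iSup₂_of_le x hx.1 (ofReal_norm _).le

end Oscillation

section Derivative

variable {𝒲 E F : Type*} [MeasurableSpace 𝒲] {Q : Measure 𝒲}
  [NormedAddCommGroup E] [NormedSpace ℝ E] [NormedAddCommGroup F] [NormedSpace ℝ F]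

lemma aestronglyMeasurable_of_forall_apply [FiniteDimensional ℝ E] {D : 𝒲 → E →L[ℝ] F}
    (hD : ∀ v, AEStronglyMeasurable (fun w => D w v) Q) : AEStronglyMeasurable D Q := by
  let b := Module.finBasis ℝ E
  have hsum (w : 𝒲) : ∑ j, ContinuousLinearMap.smulRightL ℝ E F
      (b.coord j).toContinuousLinearMap (D w (b j)) = D w := by
    refine ContinuousLinearMap.ext fun v => ?_
    conv_rhs => rw [← b.sum_repr v, map_sum]
    simp
  refine (Finset.aestronglyMeasurable_fun_sum _ fun j _ => ?_).congr (.of_forall hsum)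
  exact (ContinuousLinearMap.continuous _).comp_aestronglyMeasurable (hD (b j))

variable {f : 𝒲 → E → F} {θ₀ : E} {N : Set E}

lemma aestronglyMeasurable_fderiv_apply (hf : ∀ θ, AEStronglyMeasurable (fun w => f w θ) Q)
    (hdiff : ∀ᵐ w ∂Q, DifferentiableAt ℝ (f w) θ₀) (v : E) :
    AEStronglyMeasurable (fun w => fderiv ℝ (f w) θ₀ v) Q := by
  refine aestronglyMeasurable_of_tendsto_ae atTop
    (f := fun (n : ℕ) w => (n : ℝ) • (f w (θ₀ + (n : ℝ)⁻¹ • v) - f w θ₀))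
    (fun n => ((hf _).sub (hf _)).const_smul (n : ℝ)) ?_
  filter_upwards [hdiff] with w hw
  exact hw.hasFDerivAt.lim v (c := fun n : ℕ => (n : ℝ))
    (by simpa only [RCLike.norm_natCast] using tendsto_natCast_atTop_atTop (R := ℝ))

lemma ae_differentiableAt (hN : N ∈ 𝓝 θ₀) (hdiff : ∀ᵐ w ∂Q, DifferentiableOn ℝ (f w) N) :
    ∀ᵐ w ∂Q, DifferentiableAt ℝ (f w) θ₀ :=
  hdiff.mono fun _ hw => hw.differentiableAt hN

lemma integrable_fderiv [FiniteDimensional ℝ E] (hN : N ∈ 𝓝 θ₀)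
    (hf : ∀ θ, AEStronglyMeasurable (fun w => f w θ) Q)
    (hdiff : ∀ᵐ w ∂Q, DifferentiableOn ℝ (f w) N)
    (hdom : ExpSupFinite Q N fun w θ => ‖fderiv ℝ (f w) θ‖) :
    Integrable (fun w => fderiv ℝ (f w) θ₀) Q := by
  obtain ⟨g, hg, hdom⟩ := hdom
  refine hg.mono' (aestronglyMeasurable_of_forall_apply
    (aestronglyMeasurable_fderiv_apply hf (ae_differentiableAt hN hdiff))) ?_
  filter_upwards [hdom] with w hw using hw θ₀ (mem_of_mem_nhds hN)

/-- The remainder of the first order expansion of `φ` at `θ₀`, relative to `‖θ - θ₀‖`; it is `0` at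
`θ₀`. -/
def relRemainder (φ : E → F) (θ₀ θ : E) : F :=
  ‖θ - θ₀‖⁻¹ • (φ θ - φ θ₀ - fderiv ℝ φ θ₀ (θ - θ₀))

lemma norm_relRemainder_mul (φ : E → F) (θ₀ θ : E) :
    ‖relRemainder φ θ₀ θ‖ * ‖θ - θ₀‖ = ‖φ θ - φ θ₀ - fderiv ℝ φ θ₀ (θ - θ₀)‖ := by
  rcases eq_or_ne θ θ₀ with rfl | hne
  · simp
  · rw [relRemainder, norm_smul, norm_inv, norm_norm, mul_comm, ← mul_assoc,
      mul_inv_cancel₀ (norm_ne_zero_iff.2 (sub_ne_zero.2 hne)), one_mul]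

lemma tendsto_relRemainder {φ : E → F} (hφ : DifferentiableAt ℝ φ θ₀) :
    Tendsto (relRemainder φ θ₀) (𝓝 θ₀) (𝓝 0) := by
  refine tendsto_zero_iff_norm_tendsto_zero.2 ((hasFDerivAt_iff_tendsto.1 hφ.hasFDerivAt).congr
    fun θ => ?_)
  rw [relRemainder, norm_smul, norm_inv, norm_norm]

lemma lowerSemicontinuousOn_enorm_relRemainder {φ : E → F} {U : Set E} (hφ : ContinuousOn φ U) :
    LowerSemicontinuousOn (fun θ => ‖relRemainder φ θ₀ θ‖ₑ) U := by
  intro θ hθ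
  rcases eq_or_ne θ θ₀ with rfl | hne
  · exact fun a ha => absurd ha (by simp [relRemainder])
  · have hcont : ContinuousWithinAt (relRemainder φ θ₀) U θ :=
      ((by fun_prop : ContinuousWithinAt (fun θ => ‖θ - θ₀‖) U θ).inv₀
        (norm_ne_zero_iff.2 (sub_ne_zero.2 hne))).smul
        (((hφ θ hθ).sub continuousWithinAt_const).sub (by fun_prop))
    exact hcont.enorm.lowerSemicontinuousWithinAt

lemma norm_relRemainder_le {φ : E → F} {r C : ℝ} {θ : E} (hC : 0 ≤ C)
    (hφ : DifferentiableOn ℝ φ (Metric.ball θ₀ r))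
    (hbound : ∀ θ ∈ Metric.ball θ₀ r, ‖fderiv ℝ φ θ‖ ≤ C) (hθ : θ ∈ Metric.ball θ₀ r) :
    ‖relRemainder φ θ₀ θ‖ ≤ 2 * C := by
  have hθ₀ : θ₀ ∈ Metric.ball θ₀ r := Metric.mem_ball_self (Metric.pos_of_mem_ball hθ)
  have hincr : ‖φ θ - φ θ₀‖ ≤ C * ‖θ - θ₀‖ :=
    (convex_ball θ₀ r).norm_image_sub_le_of_norm_fderiv_le (𝕜 := ℝ)
      (fun x hx => hφ.differentiableAt (Metric.isOpen_ball.mem_nhds hx)) hbound hθ₀ hθ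
  have hlin : ‖fderiv ℝ φ θ₀ (θ - θ₀)‖ ≤ C * ‖θ - θ₀‖ :=
    ContinuousLinearMap.le_of_opNorm_le _ (hbound θ₀ hθ₀) _
  rw [relRemainder, norm_smul, norm_inv, norm_norm]
  refine inv_mul_le_of_le_mul₀ (norm_nonneg _) (by positivity) ?_
  calc _ ≤ ‖φ θ - φ θ₀‖ + ‖fderiv ℝ φ θ₀ (θ - θ₀)‖ := norm_sub_le _ _
    _ ≤ ‖θ - θ₀‖ * (2 * C) := by linarith

lemma exists_majorant_remainder [FiniteDimensional ℝ E] (hN : N ∈ 𝓝 θ₀)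
    (hf : ∀ θ, AEStronglyMeasurable (fun w => f w θ) Q)
    (hdiff : ∀ᵐ w ∂Q, DifferentiableOn ℝ (f w) N)
    (hdom : ExpSupFinite Q N fun w θ => ‖fderiv ℝ (f w) θ‖) {η : ℝ} (hη : 0 < η) :
    ∃ δ > 0, ∃ h : 𝒲 → ℝ, Integrable h Q ∧ ∫ w, h w ∂Q < η ∧
      ∀ᵐ w ∂Q, ∀ θ ∈ Metric.ball θ₀ δ,
        ‖f w θ - f w θ₀ - fderiv ℝ (f w) θ₀ (θ - θ₀)‖ ≤ h w * ‖θ - θ₀‖ := by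
  obtain ⟨g, hg, hdom⟩ := hdom
  obtain ⟨ρ, hρ, hρN⟩ := Metric.mem_nhds_iff.1 hN
  have hdiff₀ := ae_differentiableAt hN hdiff
  have hrem (θ : E) : AEStronglyMeasurable (fun w => relRemainder (f w) θ₀ θ) Q :=
    (((hf θ).sub (hf θ₀)).sub (aestronglyMeasurable_fderiv_apply hf hdiff₀ _)).const_smul _
  have hmeas : ∀ᶠ r in 𝓝[>] 0, AEMeasurable
      (fun w => ⨆ θ ∈ Metric.ball θ₀ r, ‖relRemainder (f w) θ₀ θ‖ₑ) Q := by
    filter_upwards [Ioo_mem_nhdsGT hρ] with r hr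
    refine aemeasurable_biSup_of_lowerSemicontinuousOn Metric.isOpen_ball
      (fun θ => (hrem θ).enorm) ?_
    filter_upwards [hdiff] with w hw
    exact lowerSemicontinuousOn_enorm_relRemainder
      (hw.continuousOn.mono ((Metric.ball_subset_ball hr.2.le).trans hρN))
  have hbound : ∀ᵐ w ∂Q, ∀ θ ∈ Metric.ball θ₀ ρ, ‖relRemainder (f w) θ₀ θ‖ ≤ 2 * g w := by
    filter_upwards [hdiff, hdom] with w hw hgw θ hθ
    exact norm_relRemainder_le ((norm_nonneg _).trans (hgw θ₀ (mem_of_mem_nhds hN)))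
      (hw.mono hρN) (fun θ hθ => hgw θ (hρN hθ)) hθ
  obtain ⟨δ, hδ, h, hint, hη', hmaj⟩ := exists_majorant_integral_lt hmeas
    (hdiff₀.mono fun w hw => tendsto_relRemainder hw) (hg.const_mul 2) hbound hη
  refine ⟨min δ ρ, lt_min hδ hρ, h, hint, hη', ?_⟩
  filter_upwards [hmaj] with w hw θ hθ
  rw [← norm_relRemainder_mul]
  gcongr
  exact hw θ ⟨Metric.ball_subset_ball (min_le_left _ _) hθ,
    Metric.ball_subset_ball (min_le_right _ _) hθ⟩

end Derivative

section ZEstimator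

variable {Ω 𝒲 E F : Type*} [MeasurableSpace Ω] [MeasurableSpace 𝒲] {P : Measure Ω}
  {Q : Measure 𝒲} {W : ℕ → Ω → 𝒲} [NormedAddCommGroup E] [NormedSpace ℝ E]
  [NormedAddCommGroup F] [NormedSpace ℝ F]

lemma norm_map_add_average_le {n : ℕ} {a b : ℕ → F} {D : ℕ → E →L[ℝ] F} {h : ℕ → ℝ}
    {J : E →L[ℝ] F} {u : E} {η : ℝ} (ha : ∑ i ∈ Finset.range n, a i = 0)
    (hab : ∀ i, ‖a i - b i - D i u‖ ≤ h i * ‖u‖)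
    (hD : ‖(n : ℝ)⁻¹ • ∑ i ∈ Finset.range n, D i - J‖ ≤ η)
    (hh : (n : ℝ)⁻¹ • ∑ i ∈ Finset.range n, h i ≤ η) :
    ‖J u + (n : ℝ)⁻¹ • ∑ i ∈ Finset.range n, b i‖ ≤ 2 * η * ‖u‖ := by
  have hlin : ‖((n : ℝ)⁻¹ • ∑ i ∈ Finset.range n, D i - J) u‖ ≤ η * ‖u‖ :=
    ContinuousLinearMap.le_of_opNorm_le _ hD u
  have hrem : ‖(n : ℝ)⁻¹ • ∑ i ∈ Finset.range n, (a i - b i - D i u)‖ ≤ η * ‖u‖ :=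
    calc _ ≤ (n : ℝ)⁻¹ * ∑ i ∈ Finset.range n, h i * ‖u‖ := by
          rw [norm_smul, Real.norm_of_nonneg (by positivity)]
          gcongr
          exact (norm_sum_le _ _).trans (Finset.sum_le_sum fun i _ => hab i)
      _ = ((n : ℝ)⁻¹ • ∑ i ∈ Finset.range n, h i) * ‖u‖ := by
          rw [← Finset.sum_mul, smul_eq_mul, mul_assoc]
      _ ≤ η * ‖u‖ := by gcongr
  have hid : J u + (n : ℝ)⁻¹ • ∑ i ∈ Finset.range n, b i =
      -(((n : ℝ)⁻¹ • ∑ i ∈ Finset.range n, D i - J) u) -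
        (n : ℝ)⁻¹ • ∑ i ∈ Finset.range n, (a i - b i - D i u) := by
    simp only [Finset.sum_sub_distrib, ha, _root_.sub_apply, _root_.smul_apply, _root_.sum_apply,
      smul_sub, smul_zero]
    abel
  calc _ ≤ ‖((n : ℝ)⁻¹ • ∑ i ∈ Finset.range n, D i - J) u‖ +
        ‖(n : ℝ)⁻¹ • ∑ i ∈ Finset.range n, (a i - b i - D i u)‖ := by
        rw [hid, ← norm_neg (((n : ℝ)⁻¹ • ∑ i ∈ Finset.range n, D i - J) u)]
        exact norm_sub_le _ _
    _ ≤ 2 * η * ‖u‖ := by linarith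

lemma norm_add_map_le_of_leftInverse {K : F →L[ℝ] E} {J : E →L[ℝ] F}
    (hKJ : Function.LeftInverse K J) {u : E} {s : F} {ρ : ℝ} (hρ : 2 * ‖K‖ * ρ ≤ 1)
    (hu : ‖J u + s‖ ≤ ρ * ‖u‖) : ‖u + K s‖ ≤ 2 * ‖K‖ ^ 2 * ρ * ‖s‖ := by
  rcases eq_or_ne u 0 with rfl | hu0
  · simp_all
  have hρ0 : 0 ≤ ρ := nonneg_of_mul_nonneg_left ((norm_nonneg _).trans hu) (norm_pos_iff.2 hu0)
  have hK : ‖u + K s‖ ≤ ‖K‖ * ρ * ‖u‖ :=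
    calc ‖u + K s‖ = ‖K (J u + s)‖ := by rw [map_add, hKJ]
      _ ≤ ‖K‖ * (ρ * ‖u‖) := K.le_opNorm_of_le hu
      _ = ‖K‖ * ρ * ‖u‖ := by ring
  have htri : ‖u‖ ≤ ‖u + K s‖ + ‖K‖ * ‖s‖ :=
    calc ‖u‖ = ‖u + K s - K s‖ := by rw [add_sub_cancel_right]
      _ ≤ _ := (norm_sub_le _ _).trans (by gcongr; exact K.le_opNorm s)
  have hmul : ‖K‖ * ρ * ‖u‖ ≤ ‖K‖ * ρ * (‖u + K s‖ + ‖K‖ * ‖s‖) := by gcongr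
  have hhalf : 2 * ‖K‖ * ρ * ‖u + K s‖ ≤ 1 * ‖u + K s‖ := by gcongr
  linarith

variable [FiniteDimensional ℝ E] [CompleteSpace F] {f : 𝒲 → E → F} {θ₀ : E} {N : Set E}
  {θhat : ℕ → Ω → E}

lemma withProbToOne_norm_integral_fderiv_add_average_le [IsFiniteMeasure P]
    (hW : ∀ i, HasLaw (W i) Q P) (hindep : iIndepFun W P)
    (hf : ∀ θ, AEStronglyMeasurable (fun w => f w θ) Q) (hN : N ∈ 𝓝 θ₀)
    (hdiff : ∀ᵐ w ∂Q, DifferentiableOn ℝ (f w) N)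
    (hdom : ExpSupFinite Q N fun w θ => ‖fderiv ℝ (f w) θ‖)
    (hθhat : WithProbToOne P fun n => {ω | ∑ i ∈ Finset.range n, f (W i ω) (θhat n ω) = 0})
    (hlim : TendstoInMeasure P θhat atTop fun _ => θ₀) {ρ : ℝ} (hρ : 0 < ρ) :
    WithProbToOne P fun n => {ω | ‖(∫ w, fderiv ℝ (f w) θ₀ ∂Q) (θhat n ω - θ₀) +
      (n : ℝ)⁻¹ • ∑ i ∈ Finset.range n, f (W i ω) θ₀‖ ≤ ρ * ‖θhat n ω - θ₀‖} := by
  obtain ⟨δ, hδ, h, hint, hh, hmaj⟩ :=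
    exists_majorant_remainder hN hf hdiff hdom (half_pos hρ)
  have hJ := tendstoInMeasure_average hW hindep (integrable_fderiv hN hf hdiff hdom)
  have hderiv := tendstoInMeasure_iff_withProbToOne.1 hJ (ρ / 2) (half_pos hρ)
  have hH := tendstoInMeasure_average hW hindep hint
  have hmajorant := withProbToOne_mem_of_tendstoInMeasure hH (Iio_mem_nhds hh)
  have hball := withProbToOne_mem_of_tendstoInMeasure hlim (Metric.ball_mem_nhds θ₀ hδ)
  have hexp := WithProbToOne.of_ae (ae_forall_of_hasLaw hW hmaj)
  refine ((((hderiv.inter hmajorant).inter hball).inter hexp).inter hθhat).mono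
    (.of_forall fun n => ?_)
  rintro ω ⟨⟨⟨⟨hD, hh⟩, hb⟩, hr⟩, h0⟩
  calc _ ≤ 2 * (ρ / 2) * ‖θhat n ω - θ₀‖ :=
        norm_map_add_average_le h0 (fun i => hr i _ hb) (le_of_lt hD) (le_of_lt hh)
    _ = ρ * ‖θhat n ω - θ₀‖ := by ring

lemma withProbToOne_norm_sqrt_smul_add_le [IsFiniteMeasure P]
    (hW : ∀ i, HasLaw (W i) Q P) (hindep : iIndepFun W P)
    (hf : ∀ θ, AEStronglyMeasurable (fun w => f w θ) Q) (hN : N ∈ 𝓝 θ₀)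
    (hdiff : ∀ᵐ w ∂Q, DifferentiableOn ℝ (f w) N)
    (hdom : ExpSupFinite Q N fun w θ => ‖fderiv ℝ (f w) θ‖) {K : F →L[ℝ] E}
    (hK : Function.LeftInverse K (∫ w, fderiv ℝ (f w) θ₀ ∂Q : E →L[ℝ] F))
    (hθhat : WithProbToOne P fun n => {ω | ∑ i ∈ Finset.range n, f (W i ω) (θhat n ω) = 0})
    (hlim : TendstoInMeasure P θhat atTop fun _ => θ₀) {c : ℝ} (hc : 0 < c) :
    WithProbToOne P fun n => {ω | ‖√(n : ℝ) • (θhat n ω - θ₀) +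
      K ((√(n : ℝ))⁻¹ • ∑ i ∈ Finset.range n, f (W i ω) θ₀)‖ ≤
        c * ‖(√(n : ℝ))⁻¹ • ∑ i ∈ Finset.range n, f (W i ω) θ₀‖} := by
  obtain ⟨ρ₁, hρ₁, hK₁⟩ := exists_pos_mul_lt one_pos (2 * ‖K‖)
  obtain ⟨ρ₂, hρ₂, hK₂⟩ := exists_pos_mul_lt hc (2 * ‖K‖ ^ 2)
  let ρ := min ρ₁ ρ₂
  have hρK : 2 * ‖K‖ * ρ ≤ 1 := le_trans (by gcongr; exact min_le_left _ _) hK₁.le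
  have hρc : 2 * ‖K‖ ^ 2 * ρ ≤ c := le_trans (by gcongr; exact min_le_right _ _) hK₂.le
  refine (withProbToOne_norm_integral_fderiv_add_average_le hW hindep hf hN hdiff hdom hθhat hlim
    (lt_min hρ₁ hρ₂)).mono (.of_forall fun n ω hω => ?_)
  have hsqrt : (√(n : ℝ))⁻¹ = √(n : ℝ) * (n : ℝ)⁻¹ := by
    rw [← div_eq_mul_inv, Real.sqrt_div_self]
  set s := (n : ℝ)⁻¹ • ∑ i ∈ Finset.range n, f (W i ω) θ₀
  have hscale : (√(n : ℝ))⁻¹ • ∑ i ∈ Finset.range n, f (W i ω) θ₀ = √(n : ℝ) • s := by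
    rw [hsqrt, mul_smul]
  calc _ = √(n : ℝ) * ‖θhat n ω - θ₀ + K s‖ := by
        rw [hscale, map_smul, ← smul_add, norm_smul, Real.norm_of_nonneg (Real.sqrt_nonneg _)]
    _ ≤ √(n : ℝ) * (c * ‖s‖) := by
        gcongr
        exact (norm_add_map_le_of_leftInverse hK hρK hω).trans (by gcongr)
    _ = _ := by
        rw [hscale, norm_smul (√(n : ℝ)) s, Real.norm_of_nonneg (Real.sqrt_nonneg _), mul_left_comm]

theorem tendstoInMeasure_zEstimator_expansion [IsProbabilityMeasure P] {κ : Type} [Fintype κ]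
    {f : 𝒲 → E → Euc κ}
    (hW : ∀ i, HasLaw (W i) Q P) (hindep : iIndepFun W P)
    (hf : ∀ θ, AEStronglyMeasurable (fun w => f w θ) Q) (hN : N ∈ 𝓝 θ₀)
    (hdiff : ∀ᵐ w ∂Q, DifferentiableOn ℝ (f w) N)
    (hdom : ExpSupFinite Q N fun w θ => ‖fderiv ℝ (f w) θ‖)
    (hmean : ∫ w, f w θ₀ ∂Q = 0) (hL2 : MemLp (fun w => f w θ₀) 2 Q) {K : Euc κ →L[ℝ] E}
    (hK : Function.LeftInverse K (∫ w, fderiv ℝ (f w) θ₀ ∂Q : E →L[ℝ] Euc κ))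
    (hθhat : WithProbToOne P fun n => {ω | ∑ i ∈ Finset.range n, f (W i ω) (θhat n ω) = 0})
    (hlim : TendstoInMeasure P θhat atTop fun _ => θ₀) :
    TendstoInMeasure P (fun (n : ℕ) ω => √(n : ℝ) • (θhat n ω - θ₀) +
      K ((√(n : ℝ))⁻¹ • ∑ i ∈ Finset.range n, f (W i ω) θ₀)) atTop fun _ => 0 := by
  classical
  have hclt := tendstoInDistribution_inv_sqrt_smul_sum hW hindep hL2 hmean
  exact tendstoInMeasure_zero_of_norm_le_mul hclt.forall_aemeasurable
    (isTightMeasureSet_range_map hclt) fun c hc =>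
    withProbToOne_norm_sqrt_smul_add_le hW hindep hf hN hdiff hdom hK hθhat hlim hc

lemma tendstoInDistribution_of_asymptoticallyLinear [IsProbabilityMeasure P] {κ : Type}
    [Fintype κ] [DecidableEq κ] {T : ℕ → Ω → Euc κ} {g : 𝒲 → Euc κ}
    (hW : ∀ i, HasLaw (W i) Q P) (hindep : iIndepFun W P) (hT : ∀ n, AEMeasurable (T n) P)
    (hmean : ∫ w, g w ∂Q = 0) (hL2 : MemLp g 2 Q)
    (hlin : TendstoInMeasure P
      (fun n ω => T n ω - (√(n : ℝ))⁻¹ • ∑ i ∈ Finset.range n, g (W i ω)) atTop fun _ => 0) :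
    TendstoInDistribution T atTop id (fun _ => P) (multivariateGaussian 0 (secondMoment Q g)) :=
  tendstoInDistribution_of_tendstoInMeasure_sub _ _
    (tendstoInDistribution_inv_sqrt_smul_sum hW hindep hL2 hmean) hlin hT

end ZEstimator

section MissingAtRandom

variable {Ω 𝒵 : Type*} [MeasurableSpace Ω] [MeasurableSpace 𝒵] {P : Measure Ω}
  {p : ℕ} {R : ℕ → Ω → ℝ} {Z₁ : ℕ → Ω → 𝒵} {Z₂ : ℕ → Ω → ℝ}
  {π : 𝒵 → Euc (Fin p) → ℝ} {γ₀ : Euc (Fin p)}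

namespace DataModel

lemma measurable_obs (hdata : DataModel P R Z₁ Z₂ π γ₀) (i : ℕ) :
    Measurable fun ω => (R i ω, Z₁ i ω, Z₂ i ω) :=
  (hdata.measurable_R i).prodMk ((hdata.measurable_Z₁ i).prodMk (hdata.measurable_Z₂ i))

lemma hasLaw_obs (hdata : DataModel P R Z₁ Z₂ π γ₀) (i : ℕ) :
    HasLaw (fun ω => (R i ω, Z₁ i ω, Z₂ i ω)) (obsLaw P R Z₁ Z₂) P :=
  ⟨(hdata.measurable_obs i).aemeasurable, (hdata.identDistrib i).map_eq⟩

lemma isProbabilityMeasure_obsLaw [IsProbabilityMeasure P] (hdata : DataModel P R Z₁ Z₂ π γ₀) :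
    IsProbabilityMeasure (obsLaw P R Z₁ Z₂) :=
  (hdata.hasLaw_obs 0).isProbabilityMeasure_iff.1 inferInstance

lemma R_nonneg (hdata : DataModel P R Z₁ Z₂ π γ₀) (i : ℕ) (ω : Ω) : 0 ≤ R i ω := by
  rcases hdata.binary i ω with h | h <;> simp [h]

lemma integrable_R [IsFiniteMeasure P] (hdata : DataModel P R Z₁ Z₂ π γ₀) (i : ℕ) :
    Integrable (R i) P :=
  .of_bound (hdata.measurable_R i).aestronglyMeasurable 1 <| .of_forall fun ω => by
    rcases hdata.binary i ω with h | h <;> simp [h]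

lemma measurable_propensity (hdata : DataModel P R Z₁ Z₂ π γ₀) (γ : Euc (Fin p)) :
    Measurable fun w : Obs 𝒵 => π w.2.1 γ :=
  (hdata.measurable_π γ).comp (measurable_fst.comp measurable_snd)

lemma ae_obsLaw_nonneg (hdata : DataModel P R Z₁ Z₂ π γ₀) :
    ∀ᵐ w ∂(obsLaw P R Z₁ Z₂), 0 ≤ w.1 :=
  (ae_map_iff (hdata.measurable_obs 0).aemeasurable
    (measurableSet_le measurable_const measurable_fst)).2 <| .of_forall <| hdata.R_nonneg 0

lemma ae_obsLaw_propensity_pos (hdata : DataModel P R Z₁ Z₂ π γ₀) :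
    ∀ᵐ w ∂(obsLaw P R Z₁ Z₂), 0 < π w.2.1 γ₀ :=
  (ae_map_iff (hdata.measurable_obs 0).aemeasurable
    (measurableSet_lt measurable_const (hdata.measurable_propensity γ₀))).2 hdata.positivity

variable [IsProbabilityMeasure P]

lemma map_withDensity_R (hdata : DataModel P R Z₁ Z₂ π γ₀) :
    (P.withDensity fun ω => ENNReal.ofReal (R 0 ω)).map (fun ω => (Z₁ 0 ω, Z₂ 0 ω)) =
      (P.withDensity fun ω => ENNReal.ofReal (π (Z₁ 0 ω) γ₀)).map
        (fun ω => (Z₁ 0 ω, Z₂ 0 ω)) := by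
  have hZ := (hdata.measurable_Z₁ 0).prodMk (hdata.measurable_Z₂ 0)
  have hcond := hdata.missingAtRandom.trans hdata.correctlySpecified
  have hπint : Integrable (fun ω => π (Z₁ 0 ω) γ₀) P := integrable_condExp.congr hcond
  ext S hS
  rw [Measure.map_apply hZ hS, Measure.map_apply hZ hS, withDensity_apply _ (hZ hS),
    withDensity_apply _ (hZ hS),
    ← ofReal_integral_eq_lintegral_ofReal (hdata.integrable_R 0).integrableOn
      (.of_forall (hdata.R_nonneg 0)),
    ← ofReal_integral_eq_lintegral_ofReal hπint.integrableOn
      (ae_restrict_of_ae (hdata.positivity.mono fun _ h => h.le)),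
    ← setIntegral_condExp hZ.comap_le (hdata.integrable_R 0) ⟨S, hS, rfl⟩,
    integral_congr_ae (ae_restrict_of_ae hcond)]

lemma lintegral_R_mul (hdata : DataModel P R Z₁ Z₂ π γ₀) {k : 𝒵 × ℝ → ENNReal}
    (hk : Measurable k) :
    ∫⁻ ω, ENNReal.ofReal (R 0 ω) * k (Z₁ 0 ω, Z₂ 0 ω) ∂P =
      ∫⁻ ω, ENNReal.ofReal (π (Z₁ 0 ω) γ₀) * k (Z₁ 0 ω, Z₂ 0 ω) ∂P := by
  have hZ := (hdata.measurable_Z₁ 0).prodMk (hdata.measurable_Z₂ 0)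
  have hπ : Measurable fun ω => π (Z₁ 0 ω) γ₀ :=
    (hdata.measurable_π γ₀).comp (hdata.measurable_Z₁ 0)
  have hkZ : Measurable fun ω => k (Z₁ 0 ω, Z₂ 0 ω) := hk.comp hZ
  have hmap := congrArg (fun μ => ∫⁻ z, k z ∂μ) hdata.map_withDensity_R
  simp only [lintegral_map hk hZ] at hmap
  rwa [lintegral_withDensity_eq_lintegral_mul _ (hdata.measurable_R 0).ennreal_ofReal hkZ,
    lintegral_withDensity_eq_lintegral_mul _ hπ.ennreal_ofReal hkZ] at hmap

lemma map_snd_withDensity_weight (hdata : DataModel P R Z₁ Z₂ π γ₀) :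
    ((obsLaw P R Z₁ Z₂).withDensity fun w => ENNReal.ofReal (w.1 / π w.2.1 γ₀)).map Prod.snd =
      (obsLaw P R Z₁ Z₂).map Prod.snd := by
  have hπ : Measurable fun z : 𝒵 × ℝ => ENNReal.ofReal (π z.1 γ₀) :=
    ((hdata.measurable_π γ₀).comp measurable_fst).ennreal_ofReal
  have hρ : Measurable fun w : Obs 𝒵 => ENNReal.ofReal (w.1 / π w.2.1 γ₀) :=
    (measurable_fst.div (hdata.measurable_propensity γ₀)).ennreal_ofReal
  refine Measure.ext_of_lintegral _ fun k hk => ?_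
  have hk' : Measurable fun w : Obs 𝒵 => k w.2 := hk.comp measurable_snd
  rw [lintegral_map hk measurable_snd, lintegral_map hk measurable_snd,
    lintegral_withDensity_eq_lintegral_mul _ hρ hk', obsLaw,
    lintegral_map (hρ.mul hk') (hdata.measurable_obs 0), lintegral_map hk' (hdata.measurable_obs 0)]
  calc
    _ = ∫⁻ ω, ENNReal.ofReal (R 0 ω) *
          ((ENNReal.ofReal (π (Z₁ 0 ω) γ₀))⁻¹ * k (Z₁ 0 ω, Z₂ 0 ω)) ∂P := by
        refine lintegral_congr_ae <| hdata.positivity.mono fun ω hω => ?_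
        change ENNReal.ofReal (R 0 ω / π (Z₁ 0 ω) γ₀) * k (Z₁ 0 ω, Z₂ 0 ω) = _
        rw [ENNReal.ofReal_div_of_pos hω, div_eq_mul_inv, mul_assoc]
    _ = ∫⁻ ω, ENNReal.ofReal (π (Z₁ 0 ω) γ₀) *
          ((ENNReal.ofReal (π (Z₁ 0 ω) γ₀))⁻¹ * k (Z₁ 0 ω, Z₂ 0 ω)) ∂P :=
        hdata.lintegral_R_mul (k := fun z => (ENNReal.ofReal (π z.1 γ₀))⁻¹ * k z) (hπ.inv.mul hk)
    _ = ∫⁻ ω, k (Z₁ 0 ω, Z₂ 0 ω) ∂P := by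
        refine lintegral_congr_ae <| hdata.positivity.mono fun ω hω => ?_
        exact ENNReal.mul_inv_cancel_left (by simpa using hω) ENNReal.ofReal_ne_top

lemma integral_weight_smul (hdata : DataModel P R Z₁ Z₂ π γ₀) {E : Type*}
    [NormedAddCommGroup E] [NormedSpace ℝ E] {h : 𝒵 × ℝ → E} (hh : StronglyMeasurable h) :
    ∫ w, (w.1 / π w.2.1 γ₀) • h w.2 ∂(obsLaw P R Z₁ Z₂) = ∫ w, h w.2 ∂(obsLaw P R Z₁ Z₂) := by
  have hρ : Measurable fun w : Obs 𝒵 => ENNReal.ofReal (w.1 / π w.2.1 γ₀) :=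
    (measurable_fst.div (hdata.measurable_propensity γ₀)).ennreal_ofReal
  have hmap := congrArg (fun μ => ∫ z, h z ∂μ) hdata.map_snd_withDensity_weight
  rw [integral_map measurable_snd.aemeasurable hh.aestronglyMeasurable,
    integral_map measurable_snd.aemeasurable hh.aestronglyMeasurable,
    integral_withDensity_eq_integral_toReal_smul hρ
      (.of_forall fun _ => ENNReal.ofReal_lt_top)] at hmap
  rw [← hmap]
  refine integral_congr_ae ?_
  filter_upwards [hdata.ae_obsLaw_nonneg, hdata.ae_obsLaw_propensity_pos] with w hw hπw
  rw [ENNReal.toReal_ofReal (div_nonneg hw hπw.le)]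

end DataModel

end MissingAtRandom

section EstimatingFunction

variable (ψμ ψσ : ℝ → ℝ) (A B : ℝ)

lemma mPsi_eq_shift (z : ℝ) (β : Euc (Fin 2)) :
    mPsi ψμ ψσ A B z β = mPsi ψμ ψσ A B 0 (β - EuclideanSpace.single 0 z) := by
  simp [mPsi]

lemma measurable_sub_single {ι : Type} [Fintype ι] [DecidableEq ι] (β : Euc ι) (i : ι) :
    Measurable fun z : ℝ => β - EuclideanSpace.single i z :=
  measurable_const.sub
    (Isometry.of_dist_eq fun a b =>
      PiLp.dist_single_same 2 (fun _ => ℝ) i a b).continuous.measurable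

variable {ψμ ψσ}

lemma measurable_mPsi (hψμ : Measurable ψμ) (hψσ : Measurable ψσ) (β : Euc (Fin 2)) :
    Measurable fun z => mPsi ψμ ψσ A B z β := by
  refine (PiLp.continuous_toLp 2 _).measurable.comp (measurable_pi_lambda _ fun i => ?_)
  fin_cases i
  · exact (hψμ.comp (by fun_prop)).sub_const A
  · exact ((hψσ.comp (by fun_prop)).pow_const 2).sub_const B

lemma measurable_phi {𝒵 : Type*} [MeasurableSpace 𝒵] {p : ℕ} {π : 𝒵 → Euc (Fin p) → ℝ}
    (hψμ : Measurable ψμ) (hψσ : Measurable ψσ) {γ : Euc (Fin p)}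
    (hπ : Measurable fun z => π z γ) (β : Euc (Fin 2)) :
    Measurable fun w : Obs 𝒵 => phi ψμ ψσ A B π w β γ :=
  (measurable_fst.div (hπ.comp (measurable_fst.comp measurable_snd))).smul
    ((measurable_mPsi A B hψμ hψσ β).comp (measurable_snd.comp measurable_snd))

lemma continuousAt_mPsi {z : ℝ} {β : Euc (Fin 2)}
    (hμ : ContinuousAt (fun b : Euc (Fin 2) => ψμ ((z - b 0) / b 1)) β)
    (hσ : ContinuousAt (fun b : Euc (Fin 2) => ψσ ((z - b 0) / b 1)) β) :
    ContinuousAt (mPsi ψμ ψσ A B z) β := by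
  refine (PiLp.continuous_toLp 2 _).continuousAt.comp (continuousAt_pi.2 fun i => ?_)
  fin_cases i
  · exact hμ.sub_const A
  · exact (hσ.pow 2).sub_const B

lemma continuousAt_phi {𝒵 : Type*} {p : ℕ} {π : 𝒵 → Euc (Fin p) → ℝ} {w : Obs 𝒵}
    {β : Euc (Fin 2)} {γ : Euc (Fin p)} (hπ : ContinuousAt (π w.2.1) γ) (hπ₀ : π w.2.1 γ ≠ 0)
    (hm : ContinuousAt (mPsi ψμ ψσ A B w.2.2) β) :
    ContinuousAt (fun x : Euc (Fin 2) × Euc (Fin p) => phi ψμ ψσ A B π w x.1 x.2) (β, γ) := by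
  have hπ' : ContinuousAt (fun x : Euc (Fin 2) × Euc (Fin p) => π w.2.1 x.2) (β, γ) :=
    ContinuousAt.comp (f := Prod.snd) hπ continuousAt_snd
  have hm' : ContinuousAt
      (fun x : Euc (Fin 2) × Euc (Fin p) => mPsi ψμ ψσ A B w.2.2 x.1) (β, γ) :=
    ContinuousAt.comp (g := mPsi ψμ ψσ A B w.2.2) (f := Prod.fst) hm continuousAt_fst
  exact (continuousAt_const.div hπ' hπ₀).smul hm'

variable (ψμ ψσ) in
lemma biSup_ball_enorm_phi_sub {𝒵 : Type*} {p : ℕ} (π : 𝒵 → Euc (Fin p) → ℝ) (w : Obs 𝒵)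
    (β : Euc (Fin 2)) (γ : Euc (Fin p)) (v : Euc (Fin 2)) (r : ℝ) :
    ⨆ b ∈ Metric.ball β r, ‖phi ψμ ψσ A B π w b γ - v‖ₑ =
      ⨆ c ∈ Metric.ball (β - EuclideanSpace.single 0 w.2.2) r,
        ‖(w.1 / π w.2.1 γ) • mPsi ψμ ψσ A B 0 c - v‖ₑ := by
  refine (Equiv.subRight (EuclideanSpace.single 0 w.2.2)).iSup_congr fun b => ?_
  simp only [Equiv.subRight_apply, Metric.mem_ball, dist_sub_right, phi,
    mPsi_eq_shift ψμ ψσ A B w.2.2 b]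

variable (ψμ ψσ) in
lemma measurable_biSup_ball_enorm_phi_sub {𝒵 : Type*} [MeasurableSpace 𝒵] {p : ℕ}
    {π : 𝒵 → Euc (Fin p) → ℝ} {γ : Euc (Fin p)} (hπ : Measurable fun z => π z γ)
    {v : Obs 𝒵 → Euc (Fin 2)} (hv : Measurable v) (β : Euc (Fin 2)) (r : ℝ) :
    Measurable fun w => ⨆ b ∈ Metric.ball β r, ‖phi ψμ ψσ A B π w b γ - v w‖ₑ := by
  simp only [biSup_ball_enorm_phi_sub]
  have hsup : Measurable fun q : (ℝ × Euc (Fin 2)) × Euc (Fin 2) =>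
      ⨆ c ∈ Metric.ball q.2 r, ‖q.1.1 • mPsi ψμ ψσ A B 0 c - q.1.2‖ₑ := by
    refine LowerSemicontinuous.measurable ?_
    refine lowerSemicontinuous_biSup_ball
      (u := fun (y : ℝ × Euc (Fin 2)) c => ‖y.1 • mPsi ψμ ψσ A B 0 c - y.2‖ₑ) (fun c => ?_) r
    have hcont : Continuous fun y : ℝ × Euc (Fin 2) => ‖y.1 • mPsi ψμ ψσ A B 0 c - y.2‖ₑ :=
      ((continuous_fst.smul continuous_const).sub continuous_snd).enorm
    exact hcont.lowerSemicontinuous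
  have hw : Measurable fun w : Obs 𝒵 =>
      ((w.1 / π w.2.1 γ, v w), β - EuclideanSpace.single (0 : Fin 2) w.2.2) :=
    ((measurable_fst.div (hπ.comp measurable_snd.fst)).prodMk hv).prodMk
      ((measurable_sub_single β 0).comp measurable_snd.snd)
  simpa only [Function.comp_def] using hsup.comp hw

lemma lowerSemicontinuous_enorm_inv_smul_sub {F : Type*} [NormedAddCommGroup F] [NormedSpace ℝ F]
    (m v : F) : LowerSemicontinuous fun x : ℝ => ‖x⁻¹ • m - v‖ₑ := by
  rcases eq_or_ne m 0 with rfl | hm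
  · simpa only [smul_zero] using lowerSemicontinuous_const
  intro x a ha
  rcases eq_or_ne x 0 with rfl | hx
  · have hnorm : Tendsto (fun x : ℝ => ‖x⁻¹ • m - v‖) (𝓝[≠] 0) atTop := by
      refine tendsto_atTop_mono (f := fun x : ℝ => ‖x⁻¹‖ * ‖m‖ - ‖v‖) (fun x => ?_)
        (tendsto_atTop_add_const_right _ _ ((tendsto_norm_cobounded_atTop.comp
          tendsto_inv₀_nhdsNE_zero).atTop_mul_const (norm_pos_iff.2 hm)))
      rw [← norm_smul]
      exact norm_sub_norm_le _ _
    have htop : Tendsto (fun x : ℝ => ‖x⁻¹ • m - v‖ₑ) (𝓝[≠] 0) (𝓝 ⊤) := by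
      simpa only [Function.comp_def, ofReal_norm] using ENNReal.tendsto_ofReal_nhds_top.2 hnorm
    have hev := eventually_nhdsWithin_iff.1 (htop.eventually (lt_mem_nhds (lt_top_of_lt ha)))
    filter_upwards [hev] with y hy
    rcases eq_or_ne y 0 with rfl | hy₀
    exacts [ha, hy hy₀]
  · have hcont : ContinuousAt (fun x : ℝ => ‖x⁻¹ • m - v‖ₑ) x := by fun_prop (disch := exact hx)
    exact hcont.lowerSemicontinuousAt a ha

lemma lowerSemicontinuousOn_enorm_phi_sub {𝒵 : Type*} {p : ℕ} {π : 𝒵 → Euc (Fin p) → ℝ}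
    {w : Obs 𝒵} {U : Set (Euc (Fin p))} (hπ : ContinuousOn (π w.2.1) U) (β v : Euc (Fin 2)) :
    LowerSemicontinuousOn (fun γ => ‖phi ψμ ψσ A B π w β γ - v‖ₑ) U := by
  have hlsc := (lowerSemicontinuous_enorm_inv_smul_sub (w.1 • mPsi ψμ ψσ A B w.2.2 β) v
    ).lowerSemicontinuousOn Set.univ |>.comp hπ (Set.mapsTo_univ _ _)
  simpa only [Function.comp_def, phi, div_eq_inv_mul, mul_smul] using hlsc

lemma aemeasurable_biSup_ball_enorm_phi_sub {𝒵 : Type*} [MeasurableSpace 𝒵] {Q : Measure (Obs 𝒵)}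
    {p : ℕ} {π : 𝒵 → Euc (Fin p) → ℝ} (hπ : ∀ γ, Measurable fun z => π z γ)
    {v : Obs 𝒵 → Euc (Fin 2)} (hv : Measurable v) (β : Euc (Fin 2)) {γ₀ : Euc (Fin p)} {r : ℝ}
    (hcont : ∀ᵐ w ∂Q, ContinuousOn (π w.2.1) (Metric.ball γ₀ r)) :
    AEMeasurable (fun w => ⨆ x ∈ Metric.ball (β, γ₀) r,
      ‖phi ψμ ψσ A B π w x.1 x.2 - v w‖ₑ) Q := by
  have hsplit (w : Obs 𝒵) : ⨆ x ∈ Metric.ball (β, γ₀) r, ‖phi ψμ ψσ A B π w x.1 x.2 - v w‖ₑ =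
      ⨆ γ ∈ Metric.ball γ₀ r, ⨆ b ∈ Metric.ball β r, ‖phi ψμ ψσ A B π w b γ - v w‖ₑ := by
    rw [← ball_prod_same, biSup_prod, iSup₂_comm]
  simp only [hsplit]
  refine aemeasurable_biSup_of_lowerSemicontinuousOn Metric.isOpen_ball (fun γ =>
    (measurable_biSup_ball_enorm_phi_sub ψμ ψσ A B (hπ γ) hv β r).aemeasurable) ?_
  filter_upwards [hcont] with w hw
  exact lowerSemicontinuousOn_biSup fun b _ => lowerSemicontinuousOn_enorm_phi_sub A B hw b (v w)

end EstimatingFunction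

section Consistency

lemma withProbToOne_notMem_of_majorant {Ω 𝒲 α E : Type*} [MeasurableSpace Ω] [MeasurableSpace 𝒲]
    [NormedAddCommGroup E] [NormedSpace ℝ E] [CompleteSpace E] [MeasurableSpace E] [BorelSpace E]
    {P : Measure Ω} [IsFiniteMeasure P] {Q : Measure 𝒲} {W : ℕ → Ω → 𝒲} {f : 𝒲 → α → E} {x₀ : α}
    {U : Set α} {h : 𝒲 → ℝ} {xhat : ℕ → Ω → α} (hW : ∀ i, HasLaw (W i) Q P)
    (hindep : iIndepFun W P) (hf : Integrable (fun w => f w x₀) Q) (hh : Integrable h Q)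
    (hmaj : ∀ᵐ w ∂Q, ∀ x ∈ U, ‖f w x - f w x₀‖ ≤ h w)
    (hlt : ∫ w, h w ∂Q < ‖∫ w, f w x₀ ∂Q‖)
    (hxhat : WithProbToOne P fun n => {ω | ∑ i ∈ Finset.range n, f (W i ω) (xhat n ω) = 0}) :
    WithProbToOne P fun n => {ω | xhat n ω ∉ U} := by
  have hfavg := tendstoInMeasure_average hW hindep hf
  have hhavg := tendstoInMeasure_average hW hindep hh
  have hgap := tendstoInMeasure_comp₂_of_continuousAt hfavg hhavg (φ := fun y c => ‖y‖ - c)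
    (by simp only [Function.uncurry_def]; fun_prop)
  have hpos := withProbToOne_mem_of_tendstoInMeasure hgap (Ioi_mem_nhds (sub_pos.2 hlt))
  refine ((hpos.inter (.of_ae (ae_forall_of_hasLaw hW hmaj))).inter hxhat).mono (.of_forall ?_)
  rintro n ω ⟨⟨hω, hmajω⟩, hzero⟩ hU
  rw [Set.mem_ofPred_eq, Set.mem_Ioi, sub_pos] at hω
  refine hω.not_ge ?_
  have hsum : ∑ i ∈ Finset.range n, f (W i ω) x₀ =
      -∑ i ∈ Finset.range n, (f (W i ω) (xhat n ω) - f (W i ω) x₀) := by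
    rw [Finset.sum_sub_distrib, hzero, zero_sub, neg_neg]
  rw [hsum, norm_smul, norm_neg, Real.norm_of_nonneg (by positivity), smul_eq_mul]
  gcongr
  exact (norm_sum_le _ _).trans (Finset.sum_le_sum fun i _ => hmajω i _ hU)

/-- Regularity conditions for consistency, with `π(Z₁; γ)` only continuous in `γ` near `γ₀`. -/
structure WeakConsistencyConditions {𝒵 : Type*} [MeasurableSpace 𝒵] (Q : Measure (Obs 𝒵))
    {p : ℕ} (ψμ ψσ : ℝ → ℝ) (A B : ℝ) (π : 𝒵 → Euc (Fin p) → ℝ)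
    (ℬ : Set (Euc (Fin 2))) (β₀ : Euc (Fin 2)) (γ₀ : Euc (Fin p)) : Prop where
  dominated : ∃ G : Set (Euc (Fin p)), IsOpen G ∧ γ₀ ∈ G ∧
    (∀ᵐ w ∂Q, ContinuousOn (π w.2.1) G) ∧
    ExpSupFinite Q (ℬ ×ˢ G) fun w x => ‖phi ψμ ψσ A B π w x.1 x.2‖
  compact : IsCompact ℬ
  identification : ∀ β ∈ ℬ, ∫ w, mPsi ψμ ψσ A B w.2.2 β ∂Q = 0 → β = β₀
  continuous_ψ : ∀ β ∈ ℬ, ∀ᵐ w ∂Q,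
    ContinuousAt (fun b : Euc (Fin 2) => ψμ ((w.2.2 - b 0) / b 1)) β ∧
    ContinuousAt (fun b : Euc (Fin 2) => ψσ ((w.2.2 - b 0) / b 1)) β

section

variable {𝒵 : Type*} [MeasurableSpace 𝒵] {Q : Measure (Obs 𝒵)} {p : ℕ} {ψμ ψσ : ℝ → ℝ} {A B : ℝ}
  {π : 𝒵 → Euc (Fin p) → ℝ} {ℬ : Set (Euc (Fin 2))} {β₀ : Euc (Fin 2)} {γ₀ : Euc (Fin p)}

lemma ConsistencyConditions.weak (hcons : ConsistencyConditions Q ψμ ψσ A B π ℬ β₀ γ₀) :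
    WeakConsistencyConditions Q ψμ ψσ A B π ℬ β₀ γ₀ where
  dominated := by
    obtain ⟨G, hG, hγ₀G, hsmooth, hdom⟩ := hcons.smooth_π
    exact ⟨G, hG, hγ₀G, hsmooth.mono fun w hw => hw.continuousOn, hdom⟩
  compact := hcons.compact
  identification := hcons.identification
  continuous_ψ := hcons.continuous_ψ

lemma exists_majorant_phi_sub (hψμ : Measurable ψμ) (hψσ : Measurable ψσ)
    (hπ : ∀ γ, Measurable fun z => π z γ) {G : Set (Euc (Fin p))} (hG : G ∈ 𝓝 γ₀)
    (hcont : ∀ᵐ w ∂Q, ContinuousOn (π w.2.1) G) (hπ₀ : ∀ᵐ w ∂Q, π w.2.1 γ₀ ≠ 0)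
    {β : Euc (Fin 2)} (hβ : β ∈ ℬ) (hm : ∀ᵐ w ∂Q, ContinuousAt (mPsi ψμ ψσ A B w.2.2) β)
    (hdom : ExpSupFinite Q (ℬ ×ˢ G) fun w x => ‖phi ψμ ψσ A B π w x.1 x.2‖)
    {η : ℝ} (hη : 0 < η) :
    ∃ δ > 0, ∃ h : Obs 𝒵 → ℝ, Integrable h Q ∧ ∫ w, h w ∂Q < η ∧
      ∀ᵐ w ∂Q, ∀ x ∈ Metric.ball (β, γ₀) δ ∩ ℬ ×ˢ G,
        ‖phi ψμ ψσ A B π w x.1 x.2 - phi ψμ ψσ A B π w β γ₀‖ ≤ h w := by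
  obtain ⟨g, hg, hgdom⟩ := hdom
  obtain ⟨ρ, hρ, hρG⟩ := Metric.mem_nhds_iff.1 hG
  have hmeas : ∀ᶠ r in 𝓝[>] 0, AEMeasurable (fun w => ⨆ x ∈ Metric.ball (β, γ₀) r,
      ‖phi ψμ ψσ A B π w x.1 x.2 - phi ψμ ψσ A B π w β γ₀‖ₑ) Q := by
    filter_upwards [Ioo_mem_nhdsGT hρ] with r hr
    exact aemeasurable_biSup_ball_enorm_phi_sub A B hπ (measurable_phi A B hψμ hψσ (hπ γ₀) β) β
      (hcont.mono fun w hw => hw.mono ((Metric.ball_subset_ball hr.2.le).trans hρG))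
  have hlim : ∀ᵐ w ∂Q, Tendsto (fun x : Euc (Fin 2) × Euc (Fin p) =>
      phi ψμ ψσ A B π w x.1 x.2 - phi ψμ ψσ A B π w β γ₀) (𝓝 (β, γ₀)) (𝓝 0) := by
    filter_upwards [hcont, hπ₀, hm] with w hw hπw hmw
    exact tendsto_sub_nhds_zero_iff.2 (continuousAt_phi A B (hw.continuousAt hG) hπw hmw)
  have hdom₂ : ∀ᵐ w ∂Q, ∀ x ∈ ℬ ×ˢ G,
      ‖phi ψμ ψσ A B π w x.1 x.2 - phi ψμ ψσ A B π w β γ₀‖ ≤ 2 * g w := by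
    filter_upwards [hgdom] with w hw x hx
    rw [two_mul]
    exact norm_sub_le_of_le (hw x hx) (hw (β, γ₀) ⟨hβ, mem_of_mem_nhds hG⟩)
  exact exists_majorant_integral_lt hmeas hlim (hg.const_mul 2) hdom₂ hη

end

variable {Ω 𝒵 : Type*} [MeasurableSpace Ω] [MeasurableSpace 𝒵] {P : Measure Ω}
  [IsProbabilityMeasure P] {p : ℕ} {R : ℕ → Ω → ℝ} {Z₁ : ℕ → Ω → 𝒵} {Z₂ : ℕ → Ω → ℝ}
  {π : 𝒵 → Euc (Fin p) → ℝ} {γ₀ : Euc (Fin p)} {ℬ : Set (Euc (Fin 2))} {β₀ : Euc (Fin 2)}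
  {ψμ ψσ : ℝ → ℝ} {A B : ℝ} {γhat : ℕ → Ω → Euc (Fin p)} {βhat : ℕ → Ω → Euc (Fin 2)}

lemma DataModel.integral_phi (hdata : DataModel P R Z₁ Z₂ π γ₀) (hψμ : Measurable ψμ)
    (hψσ : Measurable ψσ) (β : Euc (Fin 2)) :
    ∫ w, phi ψμ ψσ A B π w β γ₀ ∂(obsLaw P R Z₁ Z₂) =
      ∫ w, mPsi ψμ ψσ A B w.2.2 β ∂(obsLaw P R Z₁ Z₂) :=
  hdata.integral_weight_smul (h := fun z => mPsi ψμ ψσ A B z.2 β)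
    ((measurable_mPsi A B hψμ hψσ β).comp measurable_snd).stronglyMeasurable

lemma exists_nhds_withProbToOne_betahat_notMem (hdata : DataModel P R Z₁ Z₂ π γ₀)
    (hψμ : Measurable ψμ) (hψσ : Measurable ψσ)
    (hγhat_lim : TendstoInMeasure P γhat atTop fun _ => γ₀)
    (hβhat : WithProbToOne P fun n => {ω | βhat n ω ∈ ℬ ∧
      ∑ i ∈ Finset.range n,
        phi ψμ ψσ A B π (R i ω, Z₁ i ω, Z₂ i ω) (βhat n ω) (γhat n ω) = 0})
    (hcons : WeakConsistencyConditions (obsLaw P R Z₁ Z₂) ψμ ψσ A B π ℬ β₀ γ₀)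
    {β : Euc (Fin 2)} (hβ : β ∈ ℬ) (hne : β ≠ β₀) :
    ∃ U ∈ 𝓝 β, WithProbToOne P fun n => {ω | βhat n ω ∉ U} := by
  obtain ⟨G, hGo, hγ₀G, hcont, hdom⟩ := hcons.dominated
  have hG := hGo.mem_nhds hγ₀G
  have hmean : 0 < ‖∫ w, phi ψμ ψσ A B π w β γ₀ ∂(obsLaw P R Z₁ Z₂)‖ := by
    rw [hdata.integral_phi hψμ hψσ]
    exact norm_pos_iff.2 fun h => hne (hcons.identification β hβ h)
  have hint : Integrable (fun w => phi ψμ ψσ A B π w β γ₀) (obsLaw P R Z₁ Z₂) := by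
    obtain ⟨g, hg, hgdom⟩ := hdom
    exact hg.mono'
      (measurable_phi A B hψμ hψσ (hdata.measurable_π γ₀) β).aestronglyMeasurable
      (hgdom.mono fun w hw => hw (β, γ₀) ⟨hβ, hγ₀G⟩)
  obtain ⟨δ, hδ, h, hh, hlt, hmaj⟩ := exists_majorant_phi_sub hψμ hψσ hdata.measurable_π hG hcont
    (hdata.ae_obsLaw_propensity_pos.mono fun w hw => hw.ne') hβ
    ((hcons.continuous_ψ β hβ).mono fun w hw => continuousAt_mPsi A B hw.1 hw.2) hdom hmean
  have hzero : WithProbToOne P fun n => {ω | ∑ i ∈ Finset.range n,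
      phi ψμ ψσ A B π (R i ω, Z₁ i ω, Z₂ i ω) (βhat n ω) (γhat n ω) = 0} :=
    hβhat.mono (.of_forall fun _ _ hω => hω.2)
  have hout : WithProbToOne P fun n =>
      {ω | (βhat n ω, γhat n ω) ∉ Metric.ball (β, γ₀) δ ∩ ℬ ×ˢ G} :=
    withProbToOne_notMem_of_majorant hdata.hasLaw_obs hdata.indep
      (f := fun w (x : Euc (Fin 2) × Euc (Fin p)) => phi ψμ ψσ A B π w x.1 x.2) (x₀ := (β, γ₀))
      (xhat := fun n ω => (βhat n ω, γhat n ω)) hint hh hmaj hlt hzero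
  have hγ := withProbToOne_mem_of_tendstoInMeasure hγhat_lim
    (inter_mem hG (Metric.ball_mem_nhds γ₀ hδ))
  refine ⟨Metric.ball β δ, Metric.ball_mem_nhds β hδ,
    ((hout.inter hγ).inter hβhat).mono (.of_forall ?_)⟩
  rintro n ω ⟨⟨hω, hωG, hωγ⟩, hωℬ, -⟩ hωβ
  exact hω ⟨ball_prod_same β γ₀ δ ▸ ⟨hωβ, hωγ⟩, hωℬ, hωG⟩

theorem tendstoInMeasure_betahat (hdata : DataModel P R Z₁ Z₂ π γ₀)
    (hψμ : Measurable ψμ) (hψσ : Measurable ψσ)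
    (hγhat_lim : TendstoInMeasure P γhat atTop fun _ => γ₀)
    (hβhat : WithProbToOne P fun n => {ω | βhat n ω ∈ ℬ ∧
      ∑ i ∈ Finset.range n,
        phi ψμ ψσ A B π (R i ω, Z₁ i ω, Z₂ i ω) (βhat n ω) (γhat n ω) = 0})
    (hcons : WeakConsistencyConditions (obsLaw P R Z₁ Z₂) ψμ ψσ A B π ℬ β₀ γ₀) :
    TendstoInMeasure P βhat atTop fun _ => β₀ :=
  tendstoInMeasure_of_isCompact hcons.compact (hβhat.mono (.of_forall fun _ _ hω => hω.1))
    fun _ hβ hne => exists_nhds_withProbToOne_betahat_notMem hdata hψμ hψσ hγhat_lim hβhat hcons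
      hβ hne

end Consistency

section Parameter

/-- The projection `θ ↦ (μ, σ)'` of `betaPart`, as a continuous linear map. -/
def betaPartL (p : ℕ) : Euc (Fin 2 ⊕ Fin p) →L[ℝ] Euc (Fin 2) :=
  LinearMap.toContinuousLinearMap
    { toFun := betaPart, map_add' := fun _ _ => rfl, map_smul' := fun _ _ => rfl }

/-- The projection `θ ↦ γ` of `gammaPart`, as a continuous linear map. -/
def gammaPartL (p : ℕ) : Euc (Fin 2 ⊕ Fin p) →L[ℝ] Euc (Fin p) :=
  LinearMap.toContinuousLinearMap
    { toFun := gammaPart, map_add' := fun _ _ => rfl, map_smul' := fun _ _ => rfl }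

/-- The concatenation `(β, γ) ↦ θ` of `joinParam`, as a continuous linear map on the product. -/
def joinParamL (p : ℕ) : Euc (Fin 2) × Euc (Fin p) →L[ℝ] Euc (Fin 2 ⊕ Fin p) :=
  LinearMap.toContinuousLinearMap
    { toFun := fun x => joinParam x.1 x.2
      map_add' := fun x y => by ext (i | i) <;> rfl
      map_smul' := fun c x => by ext (i | i) <;> rfl }

variable {p : ℕ}

@[simp] lemma betaPartL_apply (θ : Euc (Fin 2 ⊕ Fin p)) : betaPartL p θ = betaPart θ := rfl

@[simp] lemma betaPart_joinParam (β : Euc (Fin 2)) (γ : Euc (Fin p)) :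
    betaPart (joinParam β γ) = β := rfl

lemma eq_joinParam {θ : Euc (Fin 2 ⊕ Fin p)} {β : Euc (Fin 2)} {γ : Euc (Fin p)}
    (hβ : betaPart θ = β) (hγ : gammaPart θ = γ) : θ = joinParam β γ := by
  subst hβ hγ
  ext (i | i) <;> rfl

lemma joinParam_single_zero (j : Fin 2) :
    joinParam (EuclideanSpace.single j 1) (0 : Euc (Fin p)) =
      EuclideanSpace.single (Sum.inl j) 1 := by
  ext (i | i) <;> simp [joinParam]

lemma joinParam_zero_single (j : Fin p) :
    joinParam 0 (EuclideanSpace.single j 1) = EuclideanSpace.single (Sum.inr j) 1 := by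
  ext (i | i) <;> simp [joinParam]

lemma tendstoInMeasure_joinParam {Ω : Type*} [MeasurableSpace Ω] {P : Measure Ω}
    {βhat : ℕ → Ω → Euc (Fin 2)} {γhat : ℕ → Ω → Euc (Fin p)} {β₀ : Euc (Fin 2)}
    {γ₀ : Euc (Fin p)} (hβ : TendstoInMeasure P βhat atTop fun _ => β₀)
    (hγ : TendstoInMeasure P γhat atTop fun _ => γ₀) :
    TendstoInMeasure P (fun n ω => joinParam (βhat n ω) (γhat n ω)) atTop
      fun _ => joinParam β₀ γ₀ :=
  tendstoInMeasure_comp₂_of_continuousAt hβ hγ (joinParamL p).continuous.continuousAt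

end Parameter

section Jacobian

lemma fderiv_clm_comp_comp_apply {E F G H : Type*} [NormedAddCommGroup E] [NormedSpace ℝ E]
    [NormedAddCommGroup F] [NormedSpace ℝ F] [NormedAddCommGroup G] [NormedSpace ℝ G]
    [NormedAddCommGroup H] [NormedSpace ℝ H] (L : G →L[ℝ] H) {f : F → G} {j : E → F} {x : E}
    {D : E →L[ℝ] F} (hf : DifferentiableAt ℝ f (j x)) (hj : HasFDerivAt j D x) (v : E) :
    fderiv ℝ (L ∘ f ∘ j) x v = L (fderiv ℝ f (j x) (D v)) := by
  rw [(L.hasFDerivAt.comp x (hf.hasFDerivAt.comp x hj)).fderiv]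
  rfl

lemma integral_fderiv_eq_toLpLin {𝒲 : Type*} [MeasurableSpace 𝒲] {Q : Measure 𝒲} {κ ι : Type}
    [Fintype κ] [Fintype ι] [DecidableEq κ] {f : 𝒲 → Euc κ → Euc ι} {θ₀ : Euc κ}
    (hf : Integrable (fun w => fderiv ℝ (f w) θ₀) Q) :
    (∫ w, fderiv ℝ (f w) θ₀ ∂Q).toLinearMap = Matrix.toLpLin 2 2 (expJacobian Q f θ₀) := by
  refine (EuclideanSpace.basisFun κ ℝ).toBasis.ext fun j => ?_
  ext i
  have hij := (EuclideanSpace.proj i : Euc ι →L[ℝ] ℝ).integral_comp_comm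
    (hf.apply_continuousLinearMap (EuclideanSpace.single j 1))
  rw [OrthonormalBasis.coe_toBasis, EuclideanSpace.basisFun_apply, ContinuousLinearMap.coe_coe,
    ContinuousLinearMap.integral_apply hf]
  simpa [Matrix.toLpLin_apply, expJacobian] using hij.symm

lemma leftInverse_toLpLin_inv_integral_fderiv {𝒲 : Type*} [MeasurableSpace 𝒲] {Q : Measure 𝒲}
    {κ : Type} [Fintype κ] [DecidableEq κ] {f : 𝒲 → Euc κ → Euc κ} {θ₀ : Euc κ}
    (hf : Integrable (fun w => fderiv ℝ (f w) θ₀) Q) (hunit : IsUnit (expJacobian Q f θ₀)) :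
    Function.LeftInverse (Matrix.toLpLin 2 2 (expJacobian Q f θ₀)⁻¹ : Euc κ →ₗ[ℝ] Euc κ)
      (∫ w, fderiv ℝ (f w) θ₀ ∂Q : Euc κ →L[ℝ] Euc κ) := fun u => by
  have hu := LinearMap.congr_fun (integral_fderiv_eq_toLpLin hf) u
  rw [ContinuousLinearMap.coe_coe] at hu
  rw [hu]
  simp [Matrix.toLpLin_apply, mulVec_mulVec,
    nonsing_inv_mul _ ((isUnit_iff_isUnit_det _).1 hunit)]

lemma inv_fromBlocks_mulVec_inl {m n : Type*} [Fintype m] [Fintype n] [DecidableEq m]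
    [DecidableEq n] {H : Matrix m m ℝ} {K : Matrix m n ℝ} {L : Matrix n n ℝ}
    (h : IsUnit H ↔ IsUnit L) (v : m ⊕ n → ℝ) :
    ((fromBlocks H K 0 L)⁻¹ *ᵥ v) ∘ Sum.inl =
      H⁻¹ *ᵥ (v ∘ Sum.inl - K *ᵥ (L⁻¹ *ᵥ (v ∘ Sum.inr))) := by
  rw [Matrix.inv_fromBlocks_zero₂₁_of_isUnit_iff _ _ _ h, fromBlocks_mulVec, Sum.elim_comp_inl,
    mulVec_sub, mulVec_mulVec, mulVec_mulVec, neg_mulVec, sub_eq_add_neg, Matrix.mul_assoc]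

end Jacobian

section StackedJacobian

lemma fderiv_mPsi_eq_shift (ψμ ψσ : ℝ → ℝ) (A B z : ℝ) (β : Euc (Fin 2)) :
    fderiv ℝ (mPsi ψμ ψσ A B z) β =
      fderiv ℝ (mPsi ψμ ψσ A B 0) (β - EuclideanSpace.single 0 z) := by
  rw [← fderiv_comp_sub]
  exact congrArg (fderiv ℝ · β) (funext (mPsi_eq_shift ψμ ψσ A B z))

lemma measurable_fderiv_mPsi_apply (ψμ ψσ : ℝ → ℝ) (A B : ℝ) (β v : Euc (Fin 2)) :
    Measurable fun z => fderiv ℝ (mPsi ψμ ψσ A B z) β v := by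
  simp only [fderiv_mPsi_eq_shift ψμ ψσ A B _ β]
  exact (measurable_fderiv_apply_const ℝ (mPsi ψμ ψσ A B 0) v).comp (measurable_sub_single β 0)

variable {𝒵 : Type*} {p : ℕ} {ψμ ψσ : ℝ → ℝ} {A B : ℝ} {π : 𝒵 → Euc (Fin p) → ℝ}
  {mγ : ℝ → 𝒵 → Euc (Fin p) → Euc (Fin p)} {β₀ : Euc (Fin 2)} {γ₀ : Euc (Fin p)}

lemma measurable_phiStacked [MeasurableSpace 𝒵] (hψμ : Measurable ψμ) (hψσ : Measurable ψσ)
    {θ : Euc (Fin 2 ⊕ Fin p)} (hπ : Measurable fun z => π z (gammaPart θ))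
    (hmγ : Measurable fun x : ℝ × 𝒵 => mγ x.1 x.2 (gammaPart θ)) :
    Measurable fun w => phiStacked ψμ ψσ A B π mγ w θ :=
  (joinParamL p).continuous.measurable.comp <|
    (measurable_phi A B hψμ hψσ hπ (betaPart θ)).prodMk <|
      hmγ.comp (measurable_fst.prodMk (measurable_fst.comp measurable_snd))

lemma fderiv_phiStacked_inl {w : Obs 𝒵}
    (hw : DifferentiableAt ℝ (phiStacked ψμ ψσ A B π mγ w) (joinParam β₀ γ₀)) (j : Fin 2) :
    fderiv ℝ (phiStacked ψμ ψσ A B π mγ w) (joinParam β₀ γ₀)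
        (EuclideanSpace.single (Sum.inl j) 1) =
      joinParam ((w.1 / π w.2.1 γ₀) •
        fderiv ℝ (mPsi ψμ ψσ A B w.2.2) β₀ (EuclideanSpace.single j 1)) 0 := by
  have hjoin : HasFDerivAt (fun b => joinParam b γ₀)
      ((joinParamL p).comp (ContinuousLinearMap.inl ℝ (Euc (Fin 2)) (Euc (Fin p)))) β₀ :=
    (joinParamL p).hasFDerivAt.comp β₀ (hasFDerivAt_prodMk_left β₀ γ₀)
  have hβ : betaPartL p ∘ phiStacked ψμ ψσ A B π mγ w ∘ (fun b => joinParam b γ₀) =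
      (w.1 / π w.2.1 γ₀) • mPsi ψμ ψσ A B w.2.2 := rfl
  have hγ : gammaPartL p ∘ phiStacked ψμ ψσ A B π mγ w ∘ (fun b => joinParam b γ₀) =
      fun _ => mγ w.1 w.2.1 γ₀ := rfl
  have hβ' := fderiv_clm_comp_comp_apply (betaPartL p) (j := fun b => joinParam b γ₀) hw hjoin
    (EuclideanSpace.single j 1)
  have hγ' := fderiv_clm_comp_comp_apply (gammaPartL p) (j := fun b => joinParam b γ₀) hw hjoin
    (EuclideanSpace.single j 1)
  rw [hβ, fderiv_const_smul_field] at hβ'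
  rw [hγ, fderiv_fun_const] at hγ'
  rw [← joinParam_single_zero]
  exact eq_joinParam hβ'.symm hγ'.symm

lemma fderiv_phiStacked_inr {w : Obs 𝒵}
    (hw : DifferentiableAt ℝ (phiStacked ψμ ψσ A B π mγ w) (joinParam β₀ γ₀)) (j : Fin p) :
    fderiv ℝ (phiStacked ψμ ψσ A B π mγ w) (joinParam β₀ γ₀)
        (EuclideanSpace.single (Sum.inr j) 1) =
      joinParam (fderiv ℝ (phi ψμ ψσ A B π w β₀) γ₀ (EuclideanSpace.single j 1))
        (fderiv ℝ (mγ w.1 w.2.1) γ₀ (EuclideanSpace.single j 1)) := by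
  have hjoin : HasFDerivAt (fun γ => joinParam β₀ γ)
      ((joinParamL p).comp (ContinuousLinearMap.inr ℝ (Euc (Fin 2)) (Euc (Fin p)))) γ₀ :=
    (joinParamL p).hasFDerivAt.comp γ₀ (hasFDerivAt_prodMk_right β₀ γ₀)
  have hβ := fderiv_clm_comp_comp_apply (betaPartL p) hw hjoin (EuclideanSpace.single j 1)
  have hγ := fderiv_clm_comp_comp_apply (gammaPartL p) hw hjoin (EuclideanSpace.single j 1)
  rw [← joinParam_zero_single]
  exact eq_joinParam hβ.symm hγ.symm

variable {Ω : Type*} [MeasurableSpace Ω] [MeasurableSpace 𝒵] {P : Measure Ω}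
  [IsProbabilityMeasure P] {R : ℕ → Ω → ℝ} {Z₁ : ℕ → Ω → 𝒵} {Z₂ : ℕ → Ω → ℝ}

lemma DataModel.integral_weight_smul_fderiv_mPsi (hdata : DataModel P R Z₁ Z₂ π γ₀)
    (i j : Fin 2) :
    ∫ w, ((w.1 / π w.2.1 γ₀) •
        fderiv ℝ (mPsi ψμ ψσ A B w.2.2) β₀ (EuclideanSpace.single j 1)) i ∂(obsLaw P R Z₁ Z₂) =
      expJacobian (obsLaw P R Z₁ Z₂) (fun w => mPsi ψμ ψσ A B w.2.2) β₀ i j := by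
  have hmeas : Measurable fun z : 𝒵 × ℝ =>
      fderiv ℝ (mPsi ψμ ψσ A B z.2) β₀ (EuclideanSpace.single j 1) i :=
    (EuclideanSpace.proj (𝕜 := ℝ) i).continuous.measurable.comp
      ((measurable_fderiv_mPsi_apply ψμ ψσ A B β₀ _).comp measurable_snd)
  exact hdata.integral_weight_smul hmeas.stronglyMeasurable

lemma expJacobian_phiStacked (hdata : DataModel P R Z₁ Z₂ π γ₀)
    (hdiff : ∀ᵐ w ∂(obsLaw P R Z₁ Z₂),
      DifferentiableAt ℝ (phiStacked ψμ ψσ A B π mγ w) (joinParam β₀ γ₀)) :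
    expJacobian (obsLaw P R Z₁ Z₂) (phiStacked ψμ ψσ A B π mγ) (joinParam β₀ γ₀) =
      fromBlocks (expJacobian (obsLaw P R Z₁ Z₂) (fun w => mPsi ψμ ψσ A B w.2.2) β₀)
        (expJacobian (obsLaw P R Z₁ Z₂) (fun w γ => phi ψμ ψσ A B π w β₀ γ) γ₀) 0
        (expJacobian (obsLaw P R Z₁ Z₂) (fun w => mγ w.1 w.2.1) γ₀) := by
  have hinl (i j) : expJacobian (obsLaw P R Z₁ Z₂) (phiStacked ψμ ψσ A B π mγ)
      (joinParam β₀ γ₀) i (Sum.inl j) = ∫ w, joinParam ((w.1 / π w.2.1 γ₀) •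
        fderiv ℝ (mPsi ψμ ψσ A B w.2.2) β₀ (EuclideanSpace.single j 1)) 0 i
          ∂(obsLaw P R Z₁ Z₂) :=
    integral_congr_ae (hdiff.mono fun w hw => congrArg (· i) (fderiv_phiStacked_inl hw j))
  have hinr (i j) : expJacobian (obsLaw P R Z₁ Z₂) (phiStacked ψμ ψσ A B π mγ)
      (joinParam β₀ γ₀) i (Sum.inr j) =
        ∫ w, joinParam (fderiv ℝ (phi ψμ ψσ A B π w β₀) γ₀ (EuclideanSpace.single j 1))
          (fderiv ℝ (mγ w.1 w.2.1) γ₀ (EuclideanSpace.single j 1)) i ∂(obsLaw P R Z₁ Z₂) :=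
    integral_congr_ae (hdiff.mono fun w hw => congrArg (· i) (fderiv_phiStacked_inr hw j))
  ext (i | i) (j | j)
  · exact (hinl _ j).trans (hdata.integral_weight_smul_fderiv_mPsi i j)
  · exact hinr _ j
  · exact (hinl _ j).trans (integral_zero _ _)
  · exact hinr _ j

end StackedJacobian

section Normality

/-- Regularity conditions for asymptotic normality, with the stacked estimating function only
differentiable in `θ` near `θ₀`. -/
structure WeakNormalityConditions {𝒵 : Type*} [MeasurableSpace 𝒵] (Q : Measure (Obs 𝒵))
    {p : ℕ} (ψμ ψσ : ℝ → ℝ) (A B : ℝ) (π : 𝒵 → Euc (Fin p) → ℝ)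
    (mγ : ℝ → 𝒵 → Euc (Fin p) → Euc (Fin p)) (β₀ : Euc (Fin 2)) (γ₀ : Euc (Fin p)) : Prop where
  mean_zero : ∫ w, phiStacked ψμ ψσ A B π mγ w (joinParam β₀ γ₀) ∂Q = 0
  square_integrable : MemLp (fun w => phiStacked ψμ ψσ A B π mγ w (joinParam β₀ γ₀)) 2 Q
  differentiable : ∃ N ∈ 𝓝 (joinParam β₀ γ₀),
    (∀ᵐ w ∂Q, DifferentiableOn ℝ (phiStacked ψμ ψσ A B π mγ w) N) ∧
    ExpSupFinite Q N fun w θ => ‖fderiv ℝ (phiStacked ψμ ψσ A B π mγ w) θ‖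
  nonsingular : IsUnit (expJacobian Q (phiStacked ψμ ψσ A B π mγ) (joinParam β₀ γ₀))

lemma NormalityConditions.weak {𝒵 : Type*} [MeasurableSpace 𝒵] {Q : Measure (Obs 𝒵)} {p : ℕ}
    {ψμ ψσ : ℝ → ℝ} {A B : ℝ} {π : 𝒵 → Euc (Fin p) → ℝ}
    {mγ : ℝ → 𝒵 → Euc (Fin p) → Euc (Fin p)} {ℬ : Set (Euc (Fin 2))} {Γ : Set (Euc (Fin p))}
    {β₀ : Euc (Fin 2)} {γ₀ : Euc (Fin p)}
    (hnorm : NormalityConditions Q ψμ ψσ A B π mγ ℬ Γ β₀ γ₀) :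
    WeakNormalityConditions Q ψμ ψσ A B π mγ β₀ γ₀ where
  mean_zero := hnorm.mean_zero
  square_integrable := hnorm.square_integrable
  differentiable := by
    obtain ⟨N, hN, hθ₀, hsmooth, hdom⟩ := hnorm.smooth
    exact ⟨N, hN.mem_nhds hθ₀, hsmooth.mono fun w hw => hw.differentiableOn one_ne_zero, hdom⟩
  nonsingular := isUnit_of_mul_isUnit_right hnorm.nonsingular

lemma withProbToOne_sum_phiStacked_eq_zero {Ω 𝒵 : Type*} [MeasurableSpace Ω]
    {P : Measure Ω} {p : ℕ} {ψμ ψσ : ℝ → ℝ} {A B : ℝ} {π : 𝒵 → Euc (Fin p) → ℝ}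
    {mγ : ℝ → 𝒵 → Euc (Fin p) → Euc (Fin p)} {W : ℕ → Ω → Obs 𝒵}
    {γhat : ℕ → Ω → Euc (Fin p)} {βhat : ℕ → Ω → Euc (Fin 2)}
    (hγhat : WithProbToOne P fun n => {ω |
      ∑ i ∈ Finset.range n, mγ (W i ω).1 (W i ω).2.1 (γhat n ω) = 0})
    (hβhat : WithProbToOne P fun n => {ω |
      ∑ i ∈ Finset.range n, phi ψμ ψσ A B π (W i ω) (βhat n ω) (γhat n ω) = 0}) :
    WithProbToOne P fun n => {ω | ∑ i ∈ Finset.range n,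
      phiStacked ψμ ψσ A B π mγ (W i ω) (joinParam (βhat n ω) (γhat n ω)) = 0} := by
  refine (hγhat.inter hβhat).mono (.of_forall fun n ω hω => ?_)
  have hsum : ∑ i ∈ Finset.range n,
      phiStacked ψμ ψσ A B π mγ (W i ω) (joinParam (βhat n ω) (γhat n ω)) =
        joinParamL p (∑ i ∈ Finset.range n,
          (phi ψμ ψσ A B π (W i ω) (βhat n ω) (γhat n ω),
            mγ (W i ω).1 (W i ω).2.1 (γhat n ω))) := by
    rw [map_sum]
    rfl
  rw [Set.mem_ofPred_eq, hsum, ← prod_mk_sum, hω.1, hω.2, Prod.mk_zero_zero, map_zero]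

variable {Ω 𝒵 : Type*} [MeasurableSpace Ω] [MeasurableSpace 𝒵] {P : Measure Ω}
  [IsProbabilityMeasure P] {p : ℕ} {R : ℕ → Ω → ℝ} {Z₁ : ℕ → Ω → 𝒵} {Z₂ : ℕ → Ω → ℝ}
  {π : 𝒵 → Euc (Fin p) → ℝ} {γ₀ : Euc (Fin p)} {β₀ : Euc (Fin 2)} {ψμ ψσ : ℝ → ℝ} {A B : ℝ}
  {mγ : ℝ → 𝒵 → Euc (Fin p) → Euc (Fin p)} {γhat : ℕ → Ω → Euc (Fin p)}
  {βhat : ℕ → Ω → Euc (Fin 2)}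

lemma influence_eq_neg_betaPart (hdata : DataModel P R Z₁ Z₂ π γ₀)
    (hdiff : ∀ᵐ w ∂(obsLaw P R Z₁ Z₂),
      DifferentiableAt ℝ (phiStacked ψμ ψσ A B π mγ w) (joinParam β₀ γ₀))
    (hunit : IsUnit (expJacobian (obsLaw P R Z₁ Z₂) (phiStacked ψμ ψσ A B π mγ)
      (joinParam β₀ γ₀))) (w : Obs 𝒵) :
    influence (obsLaw P R Z₁ Z₂) ψμ ψσ A B π mγ γ₀ β₀ w =
      -betaPart (Matrix.toLpLin 2 2 (expJacobian (obsLaw P R Z₁ Z₂) (phiStacked ψμ ψσ A B π mγ)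
        (joinParam β₀ γ₀))⁻¹ (phiStacked ψμ ψσ A B π mγ w (joinParam β₀ γ₀))) := by
  rw [expJacobian_phiStacked hdata hdiff] at hunit ⊢
  obtain ⟨hH, hL⟩ := isUnit_fromBlocks_zero₂₁.1 hunit
  have hinv := inv_fromBlocks_mulVec_inl (iff_of_true hH hL)
    (K := expJacobian (obsLaw P R Z₁ Z₂) (fun w γ => phi ψμ ψσ A B π w β₀ γ) γ₀)
    (phiStacked ψμ ψσ A B π mγ w (joinParam β₀ γ₀)).ofLp
  exact congrArg (fun v => -WithLp.toLp 2 v) hinv.symm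

lemma WeakNormalityConditions.exists_clm_influence_eq (hdata : DataModel P R Z₁ Z₂ π γ₀)
    (hψμ : Measurable ψμ) (hψσ : Measurable ψσ)
    (hmγ : ∀ γ, Measurable fun x : ℝ × 𝒵 => mγ x.1 x.2 γ)
    (hnorm : WeakNormalityConditions (obsLaw P R Z₁ Z₂) ψμ ψσ A B π mγ β₀ γ₀) :
    ∃ K : Euc (Fin 2 ⊕ Fin p) →L[ℝ] Euc (Fin 2 ⊕ Fin p),
      Function.LeftInverse K (∫ w, fderiv ℝ (phiStacked ψμ ψσ A B π mγ w) (joinParam β₀ γ₀)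
        ∂(obsLaw P R Z₁ Z₂) : Euc (Fin 2 ⊕ Fin p) →L[ℝ] Euc (Fin 2 ⊕ Fin p)) ∧
      influence (obsLaw P R Z₁ Z₂) ψμ ψσ A B π mγ γ₀ β₀ = fun w =>
        (-(betaPartL p).comp K) (phiStacked ψμ ψσ A B π mγ w (joinParam β₀ γ₀)) := by
  obtain ⟨N, hN, hdiff, hdom⟩ := hnorm.differentiable
  have hint : Integrable (fun w => fderiv ℝ (phiStacked ψμ ψσ A B π mγ w) (joinParam β₀ γ₀))
      (obsLaw P R Z₁ Z₂) :=
    integrable_fderiv hN (fun θ => (measurable_phiStacked hψμ hψσ (hdata.measurable_π _)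
      (hmγ _)).aestronglyMeasurable) hdiff hdom
  exact ⟨LinearMap.toContinuousLinearMap (Matrix.toLpLin 2 2 _),
    leftInverse_toLpLin_inv_integral_fderiv hint hnorm.nonsingular,
    funext (influence_eq_neg_betaPart hdata (ae_differentiableAt hN hdiff) hnorm.nonsingular)⟩

lemma tendstoInMeasure_betahat_sub_influence (hdata : DataModel P R Z₁ Z₂ π γ₀)
    (hψμ : Measurable ψμ) (hψσ : Measurable ψσ)
    (hmγ : ∀ γ, Measurable fun x : ℝ × 𝒵 => mγ x.1 x.2 γ)
    (hγhat : WithProbToOne P fun n => {ω |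
      ∑ i ∈ Finset.range n, mγ (R i ω) (Z₁ i ω) (γhat n ω) = 0})
    (hγhat_lim : TendstoInMeasure P γhat atTop fun _ => γ₀)
    (hβhat : WithProbToOne P fun n => {ω |
      ∑ i ∈ Finset.range n,
        phi ψμ ψσ A B π (R i ω, Z₁ i ω, Z₂ i ω) (βhat n ω) (γhat n ω) = 0})
    (hβhat_lim : TendstoInMeasure P βhat atTop fun _ => β₀)
    (hnorm : WeakNormalityConditions (obsLaw P R Z₁ Z₂) ψμ ψσ A B π mγ β₀ γ₀) :
    TendstoInMeasure P (fun (n : ℕ) ω => √(n : ℝ) • (βhat n ω - β₀) -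
      (√(n : ℝ))⁻¹ • ∑ i ∈ Finset.range n,
        influence (obsLaw P R Z₁ Z₂) ψμ ψσ A B π mγ γ₀ β₀ (R i ω, Z₁ i ω, Z₂ i ω))
      atTop fun _ => 0 := by
  have := hdata.isProbabilityMeasure_obsLaw
  obtain ⟨K, hK, hIF⟩ := hnorm.exists_clm_influence_eq hdata hψμ hψσ hmγ
  obtain ⟨N, hN, hdiff, hdom⟩ := hnorm.differentiable
  have hzero := withProbToOne_sum_phiStacked_eq_zero
    (W := fun i ω => (R i ω, Z₁ i ω, Z₂ i ω)) hγhat hβhat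
  have hexp := tendstoInMeasure_zEstimator_expansion hdata.hasLaw_obs hdata.indep
    (fun θ => (measurable_phiStacked hψμ hψσ (hdata.measurable_π _)
      (hmγ _)).aestronglyMeasurable) hN hdiff hdom hnorm.mean_zero hnorm.square_integrable hK
    hzero (tendstoInMeasure_joinParam hβhat_lim hγhat_lim)
  have hβ := tendstoInMeasure_clm_comp (betaPartL p) hexp
  simpa only [hIF, map_add, map_smul, map_sub, map_sum, map_zero, betaPartL_apply,
    betaPart_joinParam, _root_.neg_apply, ContinuousLinearMap.comp_apply,
    Finset.sum_neg_distrib, smul_neg, sub_neg_eq_add] using hβ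

theorem tendstoInDistribution_betahat (hdata : DataModel P R Z₁ Z₂ π γ₀)
    (hψμ : Measurable ψμ) (hψσ : Measurable ψσ)
    (hmγ : ∀ γ, Measurable fun x : ℝ × 𝒵 => mγ x.1 x.2 γ)
    (hγhat : WithProbToOne P fun n => {ω |
      ∑ i ∈ Finset.range n, mγ (R i ω) (Z₁ i ω) (γhat n ω) = 0})
    (hγhat_lim : TendstoInMeasure P γhat atTop fun _ => γ₀)
    (hβhat_meas : ∀ n, AEMeasurable (βhat n) P)
    (hβhat : WithProbToOne P fun n => {ω |
      ∑ i ∈ Finset.range n,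
        phi ψμ ψσ A B π (R i ω, Z₁ i ω, Z₂ i ω) (βhat n ω) (γhat n ω) = 0})
    (hβhat_lim : TendstoInMeasure P βhat atTop fun _ => β₀)
    (hnorm : WeakNormalityConditions (obsLaw P R Z₁ Z₂) ψμ ψσ A B π mγ β₀ γ₀) :
    MemLp (influence (obsLaw P R Z₁ Z₂) ψμ ψσ A B π mγ γ₀ β₀) 2 (obsLaw P R Z₁ Z₂) ∧
      TendstoInDistribution (fun (n : ℕ) ω => √(n : ℝ) • (βhat n ω - β₀)) atTop id (fun _ => P)
        (multivariateGaussian 0 (secondMoment (obsLaw P R Z₁ Z₂)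
          (influence (obsLaw P R Z₁ Z₂) ψμ ψσ A B π mγ γ₀ β₀))) := by
  have := hdata.isProbabilityMeasure_obsLaw
  obtain ⟨K, -, hIF⟩ := hnorm.exists_clm_influence_eq hdata hψμ hψσ hmγ
  have hL2 : MemLp (influence (obsLaw P R Z₁ Z₂) ψμ ψσ A B π mγ γ₀ β₀) 2 (obsLaw P R Z₁ Z₂) :=
    hIF ▸ (-(betaPartL p).comp K).comp_memLp' hnorm.square_integrable
  have hmean :
      ∫ w, influence (obsLaw P R Z₁ Z₂) ψμ ψσ A B π mγ γ₀ β₀ w ∂(obsLaw P R Z₁ Z₂) = 0 := by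
    rw [hIF, ContinuousLinearMap.integral_comp_comm _
      (hnorm.square_integrable.integrable one_le_two), hnorm.mean_zero, map_zero]
  exact ⟨hL2, tendstoInDistribution_of_asymptoticallyLinear hdata.hasLaw_obs hdata.indep
    (fun n => ((hβhat_meas n).sub_const β₀).const_smul (√(n : ℝ))) hmean hL2
    (tendstoInMeasure_betahat_sub_influence hdata hψμ hψσ hmγ hγhat hγhat_lim hβhat hβhat_lim
      hnorm)⟩

end Normality

section Boundedness

lemma norm_mPsi_le {ψμ ψσ : ℝ → ℝ} {Mμ Mσ : ℝ} (hμ : ∀ t, |ψμ t| ≤ Mμ) (hσ : ∀ t, |ψσ t| ≤ Mσ)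
    (A B z : ℝ) (β : Euc (Fin 2)) :
    ‖mPsi ψμ ψσ A B z β‖ ≤ (Mμ + |A|) + (Mσ ^ 2 + |B|) := by
  have hfst : |ψμ ((z - β 0) / β 1) - A| ≤ Mμ + |A| :=
    (abs_sub _ _).trans (by gcongr; exact hμ _)
  have hsnd : |ψσ ((z - β 0) / β 1) ^ 2 - B| ≤ Mσ ^ 2 + |B| :=
    (abs_sub _ _).trans (by rw [abs_pow]; gcongr; exact hσ _)
  calc ‖mPsi ψμ ψσ A B z β‖
      = √(|ψμ ((z - β 0) / β 1) - A| ^ 2 + |ψσ ((z - β 0) / β 1) ^ 2 - B| ^ 2) := by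
        simp [EuclideanSpace.norm_eq, mPsi]
    _ ≤ |ψμ ((z - β 0) / β 1) - A| + |ψσ ((z - β 0) / β 1) ^ 2 - B| := by
        rw [Real.sqrt_le_iff, add_sq]
        have hcross : 0 ≤ 2 * |ψμ ((z - β 0) / β 1) - A| * |ψσ ((z - β 0) / β 1) ^ 2 - B| := by
          positivity
        exact ⟨by positivity, by linarith⟩
    _ ≤ _ := add_le_add hfst hsnd

lemma exists_norm_influence_le {𝒵 : Type*} [MeasurableSpace 𝒵] (Q : Measure (Obs 𝒵)) {p : ℕ}
    {ψμ ψσ : ℝ → ℝ} (hμ : ∃ M, ∀ t, |ψμ t| ≤ M) (hσ : ∃ M, ∀ t, |ψσ t| ≤ M) (A B : ℝ)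
    (π : 𝒵 → Euc (Fin p) → ℝ) (mγ : ℝ → 𝒵 → Euc (Fin p) → Euc (Fin p)) (γ₀ : Euc (Fin p))
    (β : Euc (Fin 2)) (r : ℝ) (z₁ : 𝒵) :
    ∃ C, ∀ z₂ : ℝ, ‖influence Q ψμ ψσ A B π mγ γ₀ β (r, z₁, z₂)‖ ≤ C := by
  obtain ⟨Mμ, hμ⟩ := hμ
  obtain ⟨Mσ, hσ⟩ := hσ
  let T := LinearMap.toContinuousLinearMap
    (Matrix.toLpLin 2 2 (expJacobian Q (fun v => mPsi ψμ ψσ A B v.2.2) β)⁻¹ :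
      Euc (Fin 2) →ₗ[ℝ] Euc (Fin 2))
  let c : Euc (Fin 2) := WithLp.toLp 2 (expJacobian Q (fun v γ => phi ψμ ψσ A B π v β γ) γ₀ *ᵥ
    ((expJacobian Q (fun v => mγ v.1 v.2.1) γ₀)⁻¹ *ᵥ (mγ r z₁ γ₀).ofLp))
  have haffine (z₂ : ℝ) : influence Q ψμ ψσ A B π mγ γ₀ β (r, z₁, z₂) =
      -T ((r / π z₁ γ₀) • mPsi ψμ ψσ A B z₂ β - c) := rfl
  refine ⟨‖T‖ * (‖r / π z₁ γ₀‖ * ((Mμ + |A|) + (Mσ ^ 2 + |B|)) + ‖c‖), fun z₂ => ?_⟩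
  calc ‖influence Q ψμ ψσ A B π mγ γ₀ β (r, z₁, z₂)‖
      ≤ ‖T‖ * ‖(r / π z₁ γ₀) • mPsi ψμ ψσ A B z₂ β - c‖ := by
        rw [haffine, norm_neg]
        exact T.le_opNorm _
    _ ≤ ‖T‖ * (‖r / π z₁ γ₀‖ * ‖mPsi ψμ ψσ A B z₂ β‖ + ‖c‖) := by
        gcongr
        exact norm_sub_le_of_le (norm_smul_le _ _) le_rfl
    _ ≤ _ := by
        gcongr
        exact norm_mPsi_le hμ hσ A B z₂ β

end Boundedness

end RIPW

end

open RIPW in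
theorem proposition1_general {Ω 𝒵 : Type*} [MeasurableSpace Ω] [MeasurableSpace 𝒵]
    (P : Measure Ω) [IsProbabilityMeasure P] {p : ℕ}
    (R : ℕ → Ω → ℝ) (Z₁ : ℕ → Ω → 𝒵) (Z₂ : ℕ → Ω → ℝ)
    (π : 𝒵 → Euc (Fin p) → ℝ) (γ₀ : Euc (Fin p)) (hdata : DataModel P R Z₁ Z₂ π γ₀)
    (ℬ : Set (Euc (Fin 2))) (hℬ : ∀ β ∈ ℬ, 0 < β 1) (β₀ : Euc (Fin 2)) (hβ₀ : β₀ ∈ ℬ)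
    (ψμ ψσ : ℝ → ℝ) (hψμ : Measurable ψμ) (hψσ : Measurable ψσ) (A B : ℝ)
    (hA : A = ∫ ω, ψμ ((Z₂ 0 ω - β₀ 0) / β₀ 1) ∂P)
    (hB : B = ∫ ω, ψσ ((Z₂ 0 ω - β₀ 0) / β₀ 1) ^ 2 ∂P)
    (mγ : ℝ → 𝒵 → Euc (Fin p) → Euc (Fin p))
    (hmγ : ∀ γ, Measurable fun x : ℝ × 𝒵 => mγ x.1 x.2 γ)
    (γhat : ℕ → Ω → Euc (Fin p))
    (hγhat : WithProbToOne P fun n => {ω |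
      ∑ i ∈ Finset.range n, mγ (R i ω) (Z₁ i ω) (γhat n ω) = 0})
    (hγhat_lim : TendstoInMeasure P γhat atTop fun _ => γ₀)
    (βhat : ℕ → Ω → Euc (Fin 2)) (hβhat_meas : ∀ n, AEMeasurable (βhat n) P)
    (hβhat : WithProbToOne P fun n => {ω | βhat n ω ∈ ℬ ∧
      ∑ i ∈ Finset.range n,
        phi ψμ ψσ A B π (R i ω, Z₁ i ω, Z₂ i ω) (βhat n ω) (γhat n ω) = 0}) :
    (WeakConsistencyConditions (obsLaw P R Z₁ Z₂) ψμ ψσ A B π ℬ β₀ γ₀ →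
      TendstoInMeasure P βhat atTop fun _ => β₀) ∧
    (TendstoInMeasure P βhat atTop (fun _ => β₀) →
      WeakNormalityConditions (obsLaw P R Z₁ Z₂) ψμ ψσ A B π mγ β₀ γ₀ →
      MemLp (influence (obsLaw P R Z₁ Z₂) ψμ ψσ A B π mγ γ₀ β₀) 2 (obsLaw P R Z₁ Z₂) ∧
      TendstoInDistribution (fun (n : ℕ) ω => √(n : ℝ) • (βhat n ω - β₀)) atTop id (fun _ => P)
        (multivariateGaussian 0 (secondMoment (obsLaw P R Z₁ Z₂)
          (influence (obsLaw P R Z₁ Z₂) ψμ ψσ A B π mγ γ₀ β₀)))) ∧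
    ((∃ M, ∀ t, |ψμ t| ≤ M) → (∃ M, ∀ t, |ψσ t| ≤ M) →
      ∀ (β : Euc (Fin 2)) (r : ℝ) (z₁ : 𝒵), ∃ C, ∀ z₂ : ℝ,
        ‖influence (obsLaw P R Z₁ Z₂) ψμ ψσ A B π mγ γ₀ β (r, z₁, z₂)‖ ≤ C) :=
  ⟨fun hcons => tendstoInMeasure_betahat hdata hψμ hψσ hγhat_lim hβhat hcons,
    fun hβhat_lim hnorm => tendstoInDistribution_betahat hdata hψμ hψσ hmγ hγhat hγhat_lim
      hβhat_meas (hβhat.mono (.of_forall fun _ _ hω => hω.2)) hβhat_lim hnorm,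
    fun hμ hσ β r z₁ => exists_norm_influence_le _ hμ hσ A B π mγ γ₀ β r z₁⟩

open RIPW in
/-- Consistency, asymptotic normality, and boundedness of the influence function, of the robust
inverse probability weighted estimator `βhat n = (μhat, σhat)'` of `β₀ = (μ₀, σ₀)'`. -/
theorem proposition1 {Ω 𝒵 : Type*} [MeasurableSpace Ω] [MeasurableSpace 𝒵]
    (P : Measure Ω) [IsProbabilityMeasure P] {p : ℕ}
    -- data, and the model for the missingness probability
    (R : ℕ → Ω → ℝ) (Z₁ : ℕ → Ω → 𝒵) (Z₂ : ℕ → Ω → ℝ)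
    (π : 𝒵 → Euc (Fin p) → ℝ) (Γ : Set (Euc (Fin p))) (γ₀ : Euc (Fin p))
    (hdata : DataModel P R Z₁ Z₂ π γ₀)
    -- location-scale parameter, `ψ` functions and centering constants
    (ℬ : Set (Euc (Fin 2))) (hℬ : ∀ β ∈ ℬ, 0 < β 1) (β₀ : Euc (Fin 2)) (hβ₀ : β₀ ∈ ℬ)
    (ψμ ψσ : ℝ → ℝ) (hψμ : Measurable ψμ) (hψσ : Measurable ψσ) (A B : ℝ)
    (hA : A = ∫ ω, ψμ ((Z₂ 0 ω - β₀ 0) / β₀ 1) ∂P)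
    (hB : B = ∫ ω, ψσ ((Z₂ 0 ω - β₀ 0) / β₀ 1) ^ 2 ∂P)
    -- the estimator of `γ`
    (mγ : ℝ → 𝒵 → Euc (Fin p) → Euc (Fin p))
    (hmγ : ∀ γ, Measurable fun x : ℝ × 𝒵 => mγ x.1 x.2 γ)
    (γhat : ℕ → Ω → Euc (Fin p)) (hγhat_meas : ∀ n, AEMeasurable (γhat n) P)
    (hγhat : WithProbToOne P fun n => {ω | γhat n ω ∈ Γ ∧
      ∑ i ∈ Finset.range n, mγ (R i ω) (Z₁ i ω) (γhat n ω) = 0})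
    (hγhat_lim : TendstoInMeasure P γhat atTop fun _ => γ₀)
    -- the robust inverse probability weighted estimator
    (βhat : ℕ → Ω → Euc (Fin 2)) (hβhat_meas : ∀ n, AEMeasurable (βhat n) P)
    (hβhat : WithProbToOne P fun n => {ω | βhat n ω ∈ ℬ ∧
      ∑ i ∈ Finset.range n,
        phi ψμ ψσ A B π (R i ω, Z₁ i ω, Z₂ i ω) (βhat n ω) (γhat n ω) = 0}) :
    -- consistency
    (ConsistencyConditions (obsLaw P R Z₁ Z₂) ψμ ψσ A B π ℬ β₀ γ₀ →
      TendstoInMeasure P βhat atTop fun _ => β₀) ∧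
    -- asymptotic normality
    (TendstoInMeasure P βhat atTop (fun _ => β₀) →
      NormalityConditions (obsLaw P R Z₁ Z₂) ψμ ψσ A B π mγ ℬ Γ β₀ γ₀ →
      MemLp (influence (obsLaw P R Z₁ Z₂) ψμ ψσ A B π mγ γ₀ β₀) 2 (obsLaw P R Z₁ Z₂) ∧
      TendstoInDistribution (fun (n : ℕ) ω => √(n : ℝ) • (βhat n ω - β₀)) atTop id (fun _ => P)
        (multivariateGaussian 0 (secondMoment (obsLaw P R Z₁ Z₂)
          (influence (obsLaw P R Z₁ Z₂) ψμ ψσ A B π mγ γ₀ β₀)))) ∧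
    -- the influence function is bounded in `z₂` if the `ψ` functions are bounded
    ((∃ M, ∀ t, |ψμ t| ≤ M) → (∃ M, ∀ t, |ψσ t| ≤ M) →
      ∀ (β : Euc (Fin 2)) (r : ℝ) (z₁ : 𝒵), ∃ C, ∀ z₂ : ℝ,
        ‖influence (obsLaw P R Z₁ Z₂) ψμ ψσ A B π mγ γ₀ β (r, z₁, z₂)‖ ≤ C) := by
  obtain ⟨hcons, hnorm, hbdd⟩ := proposition1_general P R Z₁ Z₂ π γ₀ hdata ℬ hℬ β₀ hβ₀ ψμ ψσ hψμ
    hψσ A B hA hB mγ hmγ γhat (hγhat.mono (.of_forall fun _ _ hω => hω.2)) hγhat_lim βhat hβhat_meas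
    hβhat
  exact ⟨fun h => hcons h.weak, fun hlim h => hnorm hlim h.weak, hbdd⟩
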